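/- **Theorem 3 (Quantum Frank–Wolfe with the bounded-error Jordan algorithm).** Let $D=\{x\in\mathbb R^d:\|x\|_1\le 1\}$. Let $f:\mathbb R^d\to\mathbb R$ be convex on $D$, $G$-Lipschitz on $D$ for the Euclidean norm, and differentiable on $\mathbb R^d$ with $L$-Lipschitz gradient. Suppose that its curvature $$C_f=\sup_{x,s\in D,\ \beta\in(0,1]}\frac{2}{\beta^2}\Bigl(f(x+\beta(s-x))-f(x)-\langle\beta(s-x),\nabla f(x)\rangle\Bigr)$$ is positive. Let $0<\rho\le 1$, $\varepsilon>0$, $T=\max\{1,\lceil 4C_f/\varepsilon-2\rceil\}$ and $x^{(0)}\in D$. For $t=0,\dots,T-1$ do the following. * Put $r_t=\dfrac{\rho C_f}{16\pi d^2(d/\rho+1)L(t+2)}$ and $\gamma_t=\dfrac{2}{t+2}$. * Run the bounded-error Jordan quantum gradient estimator at $x^{(t)}$ with parameters $r=r_t$, $\rho$ and Lipschitz parameter $G'=2G$. It uses $d$ registers of $b=\lceil\log_2\frac{G'\rho}{4\pi d^2Lr}\rceil$ qubits (no qubits if this is negative), and a value register and a phase register of $c=\lceil\log_2\frac{16\pi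 d}{\rho}-1\rceil$ qubits each. It prepares the uniform superposition over $u\in\{0,\dots,2^b-1\}^d$ and the phase state $2^{-c/2}\sum_a e^{-2\pi i a/2^c}|a\rangle$. It computes $F(u)=\frac{2^b}{2G'r}\bigl[f\bigl(x^{(t)}+\frac{r}{2^b}(u-\frac{2^b}{2}\mathbb 1)\bigr)-f(x^{(t)})\bigr]$ in fixed-point arithmetic modulo $1$ with $c$ fractional bits, the two function values being rounded, adds the result to the phase register, and uncomputes $F$. It then applies to each of the $d$ registers the sign $(-1)^{u_i}$, the inverse quantum Fourier transform and a measurement with outcome $m_i$. The estimate is $g_i=\frac{2G'}{2^b}(m_i-\frac{2^b}{2})$. * Scan $g$ for a coordinate $i_t$ of largest absolute value, put $s=-\operatorname{sgn}(g_{i_t})e_{i_t}$ (with $\operatorname{sgn}(0)=1$), and set $x^{(t+1)}=(1-\gamma_t)x^{(t)}+\gamma_t s$. Then, after $T$ rounds, with probability at least $1-T\rho$, the point $x^{(T)}$ lies in $D$ and $f(x^{(T)})-\min_D f\le\varepsilon$. (So $\rho=p/T$ gives success probability at least $1-p$.) Each round makes $4=O(1)$ calls to the function value oracle $U_f:|x\rangle|a\rangle\mapsto|x\rangle|a+f(x)\rangle$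 and its inverse. With $\varepsilon_0=\min\{\varepsilon,G/2,2C_f\}$, it uses $O\bigl(d\log\frac{Gd}{\rho\varepsilon_0}\bigr)$ qubits and $O\bigl(d\log\frac{Gd}{\rho\varepsilon_0}\bigr)$ elementary gates and single-qubit measurements, with universal constants. In particular, for $d\ge2$ and given $G/(\rho\varepsilon_0)$ the number of gates is $O(d\log d)$: it is at most $K\bigl(1+\log\frac{G}{\rho\varepsilon_0}\bigr)d\log d$ for a universal constant $K$. -/

import Mathlib

namespace QFW

noncomputable section

open scoped ENNReal

/-! ### The optimization problem -/

/-- `ℝ^d` with the Euclidean norm. -/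
abbrev Vec (d : ℕ) : Type := EuclideanSpace ℝ (Fin d)

/-- The unit `ℓ₁`-ball of `ℝ^d`. -/
def l1Ball (d : ℕ) : Set (Vec d) := {x | ∑ i, |x i| ≤ 1}

/-- `f` is `L`-smooth on `ℝ^d`: differentiable, with `L`-Lipschitz gradient. -/
def IsSmooth {d : ℕ} (f : Vec d → ℝ) (L : ℝ) : Prop :=
  Differentiable ℝ f ∧ ∀ x y : Vec d, ‖gradient f x - gradient f y‖ ≤ L * ‖x - y‖

/-- `f` is `G`-Lipschitz on `D` for the Euclidean norm. -/
def IsLipschitzOn {d : ℕ} (f : Vec d → ℝ) (G : ℝ) (D : Set (Vec d)) : Prop :=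
  ∀ x ∈ D, ∀ y ∈ D, |f x - f y| ≤ G * ‖y - x‖

/-- The curvature `C_f` of `f` over `D`. -/
def curvature {d : ℕ} (f : Vec d → ℝ) (D : Set (Vec d)) : ℝ :=
  sSup {c : ℝ | ∃ x ∈ D, ∃ s ∈ D, ∃ β ∈ Set.Ioc (0 : ℝ) 1,
    c = 2 / β ^ 2 *
      (f (x + β • (s - x)) - f x - inner ℝ (β • (s - x)) (gradient f x))}

/-! ### Quantum circuits with a function value oracle

States are amplitude vectors over the computational basis of finitely many qubits. -/

/-- The amplitudes of a (not necessarily normalized) state of the qubits `Q`. -/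
abbrev State (Q : Type) : Type := (Q → Fin 2) → ℂ

/-- The squared Euclidean norm of a state. -/
def normSq {Q : Type} [Fintype Q] [DecidableEq Q] (ψ : State Q) : ℝ≥0∞ :=
  ∑ s, ‖ψ s‖ₑ ^ 2

/-- The elementary gates: Hadamard, phase rotation `diag(1, e^{iθ})`, controlled NOT and
Toffoli. The last wire of the last two is the target; such a gate is idle if the target is also
listed as a control. -/
inductive Gate (Q : Type) : Type
  | hadamard (q : Q) : Gate Q
  | phase (q : Q) (θ : ℝ) : Gate Q
  | cnot (a t : Q) : Gate Q
  | toffoli (a a' t : Q) : Gate Q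

/-- Flip the bit of wire `t` of a basis state if `P` holds. -/
def flipIf {Q : Type} [DecidableEq Q] (P : Prop) [Decidable P] (t : Q) (s : Q → Fin 2) :
    Q → Fin 2 :=
  if P then Function.update s t (s t + 1) else s

/-- The action of an elementary gate on states. -/
def Gate.apply {Q : Type} [DecidableEq Q] : Gate Q → State Q → State Q
  | .hadamard q, ψ => fun s =>
      ((1 / Real.sqrt 2 : ℝ) : ℂ) *
        (ψ (Function.update s q 0) + (-1) ^ (s q : ℕ) * ψ (Function.update s q 1))
  | .phase q θ, ψ => fun s => Complex.exp (θ * (s q : ℕ) * Complex.I) * ψ s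
  | .cnot a t, ψ => fun s => ψ (flipIf (a ≠ t ∧ s a = 1) t s)
  | .toffoli a a' t, ψ => fun s => ψ (flipIf (a ≠ t ∧ a' ≠ t ∧ s a = 1 ∧ s a' = 1) t s)

/-- The wires of the gradient estimator: `d` address registers of `b` qubits each, a value
register of `c` qubits, a phase register of `c` qubits, and one carry qubit. -/
abbrev Wire (d b c : ℕ) : Type := (Fin d × Fin b) ⊕ (Fin c ⊕ (Fin c ⊕ Unit))

variable {d b c : ℕ}

/-- Qubit `j` (of weight `2^j`) of the `i`-th address register. -/
def addrWire (i : Fin d) (j : Fin b) : Wire d b c := Sum.inl (i, j)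

/-- Qubit `j` (of weight `2^j`) of the value register. -/
def valWire (j : Fin c) : Wire d b c := Sum.inr (Sum.inl j)

/-- Qubit `j` (of weight `2^j`) of the phase register. -/
def phaseWire (j : Fin c) : Wire d b c := Sum.inr (Sum.inr (Sum.inl j))

/-- The carry qubit. -/
def carryWire : Wire d b c := Sum.inr (Sum.inr (Sum.inr ()))

/-- The integer `u_i` held by the `i`-th address register of a basis state. -/
def address (s : Wire d b c → Fin 2) (i : Fin d) : ℕ :=
  ∑ j : Fin b, (s (addrWire i j) : ℕ) * 2 ^ (j : ℕ)

/-- The point of `ℝ^d` that the address registers stand for in the fixed-point format with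
centre `x` and step `h`: the point `x + h (u - 2^b/2 · 𝟙)`. -/
def gridPoint (x : Vec d) (h : ℝ) (s : Wire d b c → Fin 2) : Vec d :=
  x + h • WithLp.toLp 2 (fun i => (address s i : ℝ) - 2 ^ b / 2)

/-- Binary words of `c` bits (bit `j` has weight `2^j`) as integers modulo `2^c`. -/
def wordEquiv (c : ℕ) : (Fin c → Fin 2) ≃ ZMod (2 ^ c) :=
  finFunctionFinEquiv.trans (ZMod.finEquiv (2 ^ c)).toEquiv

/-- The basis state `s` with the value register shifted by `k` modulo `2^c`. -/
def shiftValue (k : ZMod (2 ^ c)) (s : Wire d b c → Fin 2) : Wire d b c → Fin 2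
  | .inl p => s (.inl p)
  | .inr (.inl j) => (wordEquiv c).symm (wordEquiv c (fun j' => s (valWire j')) + k) j
  | .inr (.inr w) => s (.inr (.inr w))

/-- The function value in the fixed-point format with unit `η`: the integer nearest to
`f(point)/η`. -/
def oracleValue (f : Vec d → ℝ) (x : Vec d) (h η : ℝ) (s : Wire d b c → Fin 2) : ℤ :=
  round (f (gridPoint x h s) / η)

/-- The function value oracle `|u⟩|a⟩ ↦ |u⟩|a + f(u)⟩` (for `inv = false`) or its inverse
`|u⟩|a⟩ ↦ |u⟩|a - f(u)⟩` (for `inv = true`), where addresses are read in the fixed-point format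
with centre `x` and step `h`, and values are stored modulo `2^c` in the fixed-point format with
unit `η`. The amplitude of a basis state afterwards is the amplitude of its preimage before. -/
def oracleApply (f : Vec d → ℝ) (inv : Bool) (x : Vec d) (h η : ℝ)
    (ψ : State (Wire d b c)) : State (Wire d b c) := fun s =>
  ψ (shiftValue (if inv then (oracleValue f x h η s : ZMod (2 ^ c))
    else -(oracleValue f x h η s : ZMod (2 ^ c))) s)

/-- Quantum programs with classical output in `α`: elementary gates, oracle calls, and
single-qubit measurements in the computational basis whose outcome may steer what follows. A
program has access to `f` only through the oracle calls. -/
inductive QProg (d b c : ℕ) (α : Type) : Type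
  | ret (a : α) : QProg d b c α
  | gate (g : Gate (Wire d b c)) (k : QProg d b c α) : QProg d b c α
  | query (inv : Bool) (x : Vec d) (h η : ℝ) (k : QProg d b c α) : QProg d b c α
  | meas (q : Wire d b c) (k : Fin 2 → QProg d b c α) : QProg d b c α

/-- The part of the state in which wire `q` carries the bit `v`. -/
def project {Q : Type} (q : Q) (v : Fin 2) (ψ : State Q) : State Q :=
  fun s => if s q = v then ψ s else 0

/-- The Born weights of the classical outcomes of a program run on the state `ψ`. States are not
renormalized after a measurement, so that the squared norm of a branch is the probability of
reaching it. -/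
def QProg.weight {α : Type} (f : Vec d → ℝ) :
    QProg d b c α → State (Wire d b c) → α → ℝ≥0∞
  | .ret a, ψ => fun a' => open Classical in if a' = a then normSq ψ else 0
  | .gate g k, ψ => k.weight f (g.apply ψ)
  | .query inv x h η k, ψ => k.weight f (oracleApply f inv x h η ψ)
  | .meas q k, ψ => fun a => ∑ v, (k v).weight f (project q v ψ) a

/-- The number of elementary gates and measurements (largest over the measurement outcomes). -/
def QProg.gates {α : Type} : QProg d b c α → ℕ
  | .ret _ => 0
  | .gate _ k => k.gates + 1
  | .query _ _ _ _ k => k.gates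
  | .meas _ k => max (k 0).gates (k 1).gates + 1

/-- The number of oracle calls (largest over the measurement outcomes). -/
def QProg.queries {α : Type} : QProg d b c α → ℕ
  | .ret _ => 0
  | .gate _ k => k.queries
  | .query _ _ _ _ k => k.queries + 1
  | .meas _ k => max (k 0).queries (k 1).queries

/-- The number of qubits of the machine on which a program runs. -/
def QProg.qubits {α : Type} (_ : QProg d b c α) : ℕ := Fintype.card (Wire d b c)

/-- The initial state `|0…0⟩`. -/
def zeroState (Q : Type) [Fintype Q] [DecidableEq Q] : State Q :=
  fun s => if s = fun _ => 0 then 1 else 0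

/-! #### The outcome weights of a program form a probability distribution -/

lemma normSq_perm {Q : Type} [Fintype Q] [DecidableEq Q] (ψ : State Q)
    (σ : (Q → Fin 2) → (Q → Fin 2)) (hσ : Function.Injective σ) :
    normSq (fun s => ψ (σ s)) = normSq ψ :=
  (Equiv.ofBijective σ (Finite.injective_iff_bijective.mp hσ)).sum_comp
    (fun s => ‖ψ s‖ₑ ^ 2)

lemma fin2_add_one_add_one (a : Fin 2) : a + 1 + 1 = a := by fin_cases a <;> rfl

lemma flip_flip {Q : Type} [DecidableEq Q] (t : Q) (s : Q → Fin 2) :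
    Function.update (Function.update s t (s t + 1)) t
      ((Function.update s t (s t + 1)) t + 1) = s := by
  simp [fin2_add_one_add_one]

lemma normSq_hadamard {Q : Type} [Fintype Q] [DecidableEq Q] (q : Q) (ψ : State Q) :
    normSq ((Gate.hadamard q).apply ψ) = normSq ψ := by
  set e : (Q → Fin 2) ≃ (Q → Fin 2) :=
    ⟨fun s => Function.update s q (s q + 1), fun s => Function.update s q (s q + 1),
      flip_flip q, flip_flip q⟩ with he
  have conv : ∀ φ : State Q, normSq φ = ENNReal.ofReal (∑ s, ‖φ s‖ ^ 2) := by
    intro φ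
    rw [normSq, ENNReal.ofReal_sum_of_nonneg (fun _ _ => by positivity)]
    refine Finset.sum_congr rfl fun s _ => ?_
    rw [ENNReal.ofReal_pow (norm_nonneg _), ofReal_norm]
  rw [conv, conv]
  congr 1
  have dbl : ∀ φ : State Q, 2 * ∑ s, ‖φ s‖ ^ 2 = ∑ s, (‖φ s‖ ^ 2 + ‖φ (e s)‖ ^ 2) := by
    intro φ
    rw [Finset.sum_add_distrib, e.sum_comp (fun s => ‖φ s‖ ^ 2)]
    ring
  have key : 2 * ∑ s, ‖(Gate.hadamard q).apply ψ s‖ ^ 2 = 2 * ∑ s, ‖ψ s‖ ^ 2 := by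
    rw [dbl, dbl]
    refine Finset.sum_congr rfl fun s => fun _ => ?_
    have para : ∀ x y : ℂ, ‖((1 / Real.sqrt 2 : ℝ) : ℂ) * (x + y)‖ ^ 2
        + ‖((1 / Real.sqrt 2 : ℝ) : ℂ) * (x - y)‖ ^ 2 = ‖x‖ ^ 2 + ‖y‖ ^ 2 := by
      intro x y
      have h := parallelogram_law_with_norm ℝ x y
      rw [norm_mul, norm_mul, mul_pow, mul_pow, Complex.norm_real, Real.norm_eq_abs, sq_abs,
        div_pow, one_pow, Real.sq_sqrt (by norm_num)]
      nlinarith [h]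
    have hs : s q = 0 ∨ s q = 1 := by
      generalize s q = a
      fin_cases a <;> simp
    rcases hs with h | h
    · have h0 : Function.update s q 0 = s := by rw [← h, Function.update_eq_self]
      simpa [Gate.apply, he, h, h0, sub_eq_add_neg] using
        para (ψ s) (ψ (Function.update s q 1))
    · have h0 : Function.update s q 1 = s := by rw [← h, Function.update_eq_self]
      have h2 : (1 : Fin 2) + 1 = 0 := rfl
      have := para (ψ (Function.update s q 0)) (ψ s)
      simp only [Gate.apply, he, h, h0, h2, Equiv.coe_fn_mk, Function.update_idem,
        Function.update_self, Fin.val_one, pow_one, Fin.val_zero, pow_zero, one_mul, neg_one_mul,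
        ← sub_eq_add_neg]
      linarith
  linarith

lemma normSq_gate {Q : Type} [Fintype Q] [DecidableEq Q] (g : Gate Q) (ψ : State Q) :
    normSq (g.apply ψ) = normSq ψ := by
  cases g with
  | hadamard q => exact normSq_hadamard q ψ
  | phase q θ =>
    refine Finset.sum_congr rfl fun s _ => ?_
    have h : ‖Complex.exp ((θ : ℂ) * ((s q : ℕ) : ℂ) * Complex.I)‖ = 1 := by
      have := Complex.norm_exp_ofReal_mul_I (θ * ((s q : ℕ) : ℝ))
      push_cast at this
      exact this
    have h' : ‖Complex.exp ((θ : ℂ) * ((s q : ℕ) : ℂ) * Complex.I)‖ₑ = 1 := by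
      rw [← ofReal_norm, h, ENNReal.ofReal_one]
    simp only [Gate.apply]
    rw [enorm_mul, h', one_mul]
  | cnot a t =>
    refine normSq_perm ψ _ (Function.LeftInverse.injective
      (g := fun s => flipIf (a ≠ t ∧ s a = 1) t s) fun s => ?_)
    by_cases h : a ≠ t ∧ s a = 1
    · simp [flipIf, h, fin2_add_one_add_one]
    · simp only [flipIf, h, if_false]
  | toffoli a a' t =>
    refine normSq_perm ψ _ (Function.LeftInverse.injective
      (g := fun s => flipIf (a ≠ t ∧ a' ≠ t ∧ s a = 1 ∧ s a' = 1) t s) fun s => ?_)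
    by_cases h : a ≠ t ∧ a' ≠ t ∧ s a = 1 ∧ s a' = 1
    · simp [flipIf, h, fin2_add_one_add_one]
    · simp only [flipIf, h, if_false]

lemma shiftValue_shiftValue (k k' : ZMod (2 ^ c)) (s : Wire d b c → Fin 2) :
    shiftValue k' (shiftValue k s) = shiftValue (k + k') s := by
  funext w
  rcases w with p | j | w
  · rfl
  · simp [shiftValue, valWire, add_assoc]
  · rfl

lemma shiftValue_zero (s : Wire d b c → Fin 2) : shiftValue 0 s = s := by
  funext w
  rcases w with p | j | w
  · rfl
  · simp [shiftValue, valWire]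
  · rfl

lemma oracleValue_shiftValue (f : Vec d → ℝ) (x : Vec d) (h η : ℝ) (k : ZMod (2 ^ c))
    (s : Wire d b c → Fin 2) :
    oracleValue f x h η (shiftValue k s) = oracleValue f x h η s := rfl

lemma normSq_oracle (f : Vec d → ℝ) (inv : Bool) (x : Vec d) (h η : ℝ)
    (ψ : State (Wire d b c)) : normSq (oracleApply f inv x h η ψ) = normSq ψ := by
  refine normSq_perm ψ _ (Function.LeftInverse.injective
    (g := fun s => shiftValue (-(if inv then (oracleValue f x h η s : ZMod (2 ^ c))
    else -(oracleValue f x h η s : ZMod (2 ^ c)))) s) fun s => ?_)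
  simp only [oracleValue_shiftValue, shiftValue_shiftValue, add_neg_cancel, shiftValue_zero]

lemma normSq_project {Q : Type} [Fintype Q] [DecidableEq Q] (q : Q) (ψ : State Q) :
    ∑ v, normSq (project q v ψ) = normSq ψ := by
  unfold normSq
  rw [Finset.sum_comm]
  refine Finset.sum_congr rfl fun s _ => ?_
  rw [Finset.sum_eq_single (s q)]
  · simp [project]
  · intro v _ hv
    simp [project, hv.symm]
  · simp

lemma QProg.tsum_weight {α : Type} (f : Vec d → ℝ) (P : QProg d b c α)
    (ψ : State (Wire d b c)) : ∑' a, P.weight f ψ a = normSq ψ := by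
  induction P generalizing ψ with
  | ret a => simp only [QProg.weight, tsum_ite_eq]
  | gate g k ih => simp only [QProg.weight, ih, normSq_gate]
  | query inv x h η k ih => simp only [QProg.weight, ih, normSq_oracle]
  | meas q k ih =>
    simp only [QProg.weight]
    rw [Summable.tsum_finsetSum (fun _ _ => ENNReal.summable)]
    simp only [ih, normSq_project]

lemma normSq_zeroState (Q : Type) [Fintype Q] [DecidableEq Q] : normSq (zeroState Q) = 1 := by
  unfold normSq
  rw [Finset.sum_eq_single (fun _ => 0)]
  · simp [zeroState]
  · intro s _ hs
    simp [zeroState, hs]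
  · simp

/-- The distribution of the classical output of a program started in `|0…0⟩`, when the oracle is
the function value oracle of `f`. -/
def QProg.law {α : Type} (f : Vec d → ℝ) (P : QProg d b c α) : PMF α :=
  ⟨P.weight f (zeroState (Wire d b c)), by
    have h := P.tsum_weight f (zeroState (Wire d b c))
    rw [normSq_zeroState] at h
    exact h ▸ ENNReal.summable.hasSum⟩

/-! ### The bounded-error Jordan gradient estimator -/

/-- Apply a list of gates, then go on with `k`. -/
def runGates {α : Type} (gs : List (Gate (Wire d b c))) (k : QProg d b c α) : QProg d b c α :=
  gs.foldr QProg.gate k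

/-- Ripple-carry addition modulo a power of two: for a list of pairs of wires `(p, y)`, least
significant first, adds the number on the wires `p` to the number on the wires `y`. The wire
`z` supplies the carry. -/
def adder {Q : Type} : List (Q × Q) → Q → List (Gate Q)
  | [], _ => []
  | (p, y) :: rest, z =>
      [.cnot p y, .cnot p z, .toffoli z y p] ++ adder rest p ++
        [.toffoli z y p, .cnot p z, .cnot z y]

/-- Inverse quantum Fourier transform of one register followed by its measurement, in the
semiclassical form: the qubits are treated from the most significant one down, each is rotated
by an angle that depends on the bits measured so far and then measured after a Hadamard gate.
`k` counts the bits found so far and `M` is the number they form; the outcome is handed to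
`cont`. -/
def iqftMeasure {α : Type} (cont : ℕ → QProg d b c α) :
    List (Wire d b c) → ℕ → ℕ → QProg d b c α
  | [], _, M => cont M
  | q :: qs, k, M =>
      .gate (.phase q (-(2 * Real.pi * M / 2 ^ (k + 1)))) <|
      .gate (.hadamard q) <|
      .meas q fun v => iqftMeasure cont qs (k + 1) (M + (v : ℕ) * 2 ^ k)

/-- Inverse Fourier transform and measurement of the listed address registers in turn. -/
def measureRegisters : List (Fin d) → (Fin d → ℕ) → QProg d b c (Fin d → ℕ)
  | [], m => .ret m
  | i :: is, m =>
      iqftMeasure (fun M => measureRegisters is (Function.update m i M))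
        ((List.finRange b).reverse.map (addrWire i)) 0 0

/-- The circuit of the gradient estimator at the point `x`, for a grid of side length `r` and
the Lipschitz parameter `G`, with `b` qubits per coordinate and `c` qubits for the values. Its
output consists of the measured integers `m_1, …, m_d`. -/
def jordanCircuit (d b c : ℕ) (x : Vec d) (r G : ℝ) : QProg d b c (Fin d → ℕ) :=
  -- values are stored in units of `η`, so that the value register holds `2^c F(u)`, where
  -- `F(u) = 2^b / (2 G r) (f(x + r / 2^b (u - 2^b/2)) - f(x))`
  let η : ℝ := 2 * G * r / (2 ^ b * 2 ^ c)
  -- the phase register: `2^{-c/2} ∑_a e^{-2 π i a / 2^c} |a⟩`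
  runGates ((List.finRange c).flatMap fun j =>
    [.hadamard (phaseWire j), .phase (phaseWire j) (-(2 * Real.pi * 2 ^ (j : ℕ) / 2 ^ c))]) <|
  -- Hadamard transform of the address registers
  runGates ((List.finRange d).flatMap fun i =>
    (List.finRange b).map fun j => .hadamard (addrWire i j)) <|
  -- evaluation of `F`
  .query false x (r / 2 ^ b) η <|
  .query true x 0 η <|
  -- addition modulo `2^c` of the value register to the phase register
  runGates (adder ((List.finRange c).map fun j => (valWire j, phaseWire j)) carryWire) <|
  -- uncomputation of `F`
  .query false x 0 η <|
  .query true x (r / 2 ^ b) η <|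
  -- the sign `(-1)^u`, by which the outcomes of the Fourier transform are centred at `2^b/2`
  runGates ((List.finRange d).flatMap fun i =>
    (List.finRange b).map fun j => .phase (addrWire i j) (Real.pi * 2 ^ (j : ℕ))) <|
  -- inverse Fourier transforms and measurement
  measureRegisters (List.finRange d) 0

/-- The number of qubits per coordinate, `b = ⌈log₂ (Gρ / (4πd²Lr))⌉`. -/
def addrBits (d : ℕ) (G L ρ r : ℝ) : ℕ :=
  ⌈Real.logb 2 (G * ρ / (4 * Real.pi * d ^ 2 * L * r))⌉₊

/-- The number of qubits of a value, `c = ⌈log₂ (16πd / ρ) - 1⌉`. -/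
def valBits (d : ℕ) (ρ : ℝ) : ℕ := ⌈Real.logb 2 (16 * Real.pi * d / ρ) - 1⌉₊

/-- The bounded-error Jordan gradient estimator at `x` with the parameters `r` and `ρ`, for
`L`-smooth functions and the Lipschitz parameter `G`. -/
def jordan (d : ℕ) (G L ρ r : ℝ) (x : Vec d) :
    QProg d (addrBits d G L ρ r) (valBits d ρ) (Fin d → ℕ) :=
  jordanCircuit d (addrBits d G L ρ r) (valBits d ρ) x r G

/-- The gradient estimate `g_i = 2G/2^b (m_i - 2^b/2)` read off from the measured integers. -/
def gradientEstimate (b : ℕ) (G : ℝ) (m : Fin d → ℕ) (i : Fin d) : ℝ :=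
  2 * G / 2 ^ b * ((m i : ℝ) - 2 ^ b / 2)

/-! ### The Frank-Wolfe iteration -/

/-- The vertex `-sgn(g_i) e_i` of the `ℓ₁`-ball, where `i` is the first coordinate that a scan
of all components of `g` finds to have the largest absolute value. -/
def direction (g : Fin d → ℝ) : Vec d :=
  match (List.finRange d).argmax (fun i => |g i|) with
  | none => 0
  | some i => if 0 ≤ g i then -EuclideanSpace.single i 1 else EuclideanSpace.single i 1

/-- The step size `γ_t = 2/(t+2)`. -/
def stepSize (t : ℕ) : ℝ := 2 / (t + 2)

/-- The parameter `r_t = ρ C_f / (16 π d² (d/ρ + 1) L (t + 2))`. -/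
def gridSize (d : ℕ) (L ρ C : ℝ) (t : ℕ) : ℝ :=
  ρ * C / (16 * Real.pi * d ^ 2 * (d / ρ + 1) * L * (t + 2))

/-- The quantum program of round `t` at the iterate `x`, where `C` is the curvature. The gradient
estimator is given the Lipschitz parameter `2G`, so that the measured integers of a gradient with
components in `[-G, G]` stay away from the ends of their range. -/
def roundProgram (d : ℕ) (G L ρ C : ℝ) (t : ℕ) (x : Vec d) :
    QProg d (addrBits d (2 * G) L ρ (gridSize d L ρ C t)) (valBits d ρ) (Fin d → ℕ) :=
  jordan d (2 * G) L ρ (gridSize d L ρ C t) x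

/-- The next iterate `(1 - γ_t) x + γ_t s`, computed from the integers measured in round `t`. -/
def nextIterate (d : ℕ) (G L ρ C : ℝ) (t : ℕ) (x : Vec d) (m : Fin d → ℕ) : Vec d :=
  (1 - stepSize t) • x + stepSize t •
    direction (gradientEstimate (addrBits d (2 * G) L ρ (gridSize d L ρ C t)) (2 * G) m)

/-- The distribution of the iterate after the given number of rounds, from the start `x₀`. The
rounds are numbered from `0`. -/
def iterateLaw (f : Vec d → ℝ) (G L ρ C : ℝ) (x₀ : Vec d) : ℕ → PMF (Vec d)
  | 0 => PMF.pure x₀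
  | t + 1 => (iterateLaw f G L ρ C x₀ t).bind fun x =>
      ((roundProgram d G L ρ C t x).law f).map (nextIterate d G L ρ C t x)

/-- The number of rounds: `4C/ε - 2`, rounded up, and at least one. -/
def rounds (C ε : ℝ) : ℕ := max 1 ⌈4 * C / ε - 2⌉₊

end

end QFW

namespace QFW

open scoped ENNReal

/-! ### Gate lists and quadratic behaviour of the outcome weights -/

/-! The argument separates the optimization from the quantum estimate.

Frank–Wolfe tolerates an inexact linear subproblem. If round `t` solves it up to `C/(t+2)`, the gap
`h_t = f(x_t) - min f` satisfies `h_{t+1} ≤ (1 - γ_t) h_t + γ_t C/(t+2) + γ_t² C/2`, by convexity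
and the definition of the curvature. Since `γ_t = 2/(t+2)`, induction gives `h_t ≤ 4C/(t+2)` for `t
≥ 1` (`step_mem_goodPoints`), which is at most `ε` after `rounds C ε` rounds. On the `ℓ₁`-ball, a
gradient estimate with componentwise error `C/(2(t+2))` yields a sufficiently good vertex
(`inner_direction_le`).

The circuit computes the difference of two rounded function values and adds it to a phase register
holding a Fourier state. By phase kickback this multiplies each basis state by a phase and leaves
the other registers unchanged (`evaluate_add_uncompute`). If `f` were affine and values exact, the
result would be a product of Fourier states with phases `1/2 + v_i/(2G')`, where `v` is the gradient
and `G'` the Lipschitz parameter of the estimator. The semiclassical Fourier transform of such a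
product state has outcome probabilities `∏ cos²`, a squared Fejér-type kernel
(`expect_iqftMeasure_le`). Its tail beyond distance `k` is at most `1/(π(k - 1/2))`, by telescoping
cotangents (`sum_cosProd_tail_le`).

The Taylor remainder and the rounding perturb the phases by at most `3ρ/(8d)` (`phase_error_le`).
Actual and ideal state have amplitudes of equal modulus, so they differ by at most that much in
norm, and outcome weights, being quadratic in the state, change in a controlled way
(`two_mul_expect_add_le`). With `k = d/ρ + 1` each component fails with probability at most `ρ/d`.
Union bounds over components and rounds give `ρ` per round and `Tρ` in total.

For the resources, the semiclassical transform costs three operations per qubit and the adder six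
gates per bit, so the gate count is linear in the number of qubits. The register lengths are
`O(log(Gd/(ρε₀)))`. -/

/-- The action of a list of gates, the first gate acting first. -/
noncomputable def applyGates {Q : Type} [DecidableEq Q] (gs : List (Gate Q)) (ψ : State Q) :
    State Q :=
  gs.foldl (fun φ g => g.apply φ) ψ

lemma applyGates_nil {Q : Type} [DecidableEq Q] (ψ : State Q) : applyGates [] ψ = ψ := rfl

lemma applyGates_cons {Q : Type} [DecidableEq Q] (g : Gate Q) (gs : List (Gate Q)) (ψ : State Q) :
    applyGates (g :: gs) ψ = applyGates gs (g.apply ψ) := rfl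

lemma applyGates_append {Q : Type} [DecidableEq Q] (gs hs : List (Gate Q)) (ψ : State Q) :
    applyGates (gs ++ hs) ψ = applyGates hs (applyGates gs ψ) := by
  simp [applyGates]

lemma weight_runGates {d b c : ℕ} {α : Type} (f : Vec d → ℝ) (gs : List (Gate (Wire d b c)))
    (k : QProg d b c α) (ψ : State (Wire d b c)) :
    (runGates gs k).weight f ψ = k.weight f (applyGates gs ψ) := by
  induction gs generalizing ψ with
  | nil => rfl
  | cons g gs ih => exact ih (g.apply ψ)

lemma Gate.apply_smul {Q : Type} [DecidableEq Q] (g : Gate Q) (z : ℂ) (ψ : State Q) :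
    g.apply (z • ψ) = z • g.apply ψ := by
  cases g <;> funext s <;> simp only [Gate.apply, Pi.smul_apply, smul_eq_mul] <;> ring

lemma Gate.apply_add {Q : Type} [DecidableEq Q] (g : Gate Q) (ψ φ : State Q) :
    g.apply (ψ + φ) = g.apply ψ + g.apply φ := by
  cases g <;> funext s <;> simp only [Gate.apply, Pi.add_apply] <;> ring

lemma project_smul {Q : Type} [DecidableEq Q] (q : Q) (v : Fin 2) (z : ℂ) (ψ : State Q) :
    project q v (z • ψ) = z • project q v ψ := by
  funext s; simp [project]

lemma project_add {Q : Type} [DecidableEq Q] (q : Q) (v : Fin 2) (ψ φ : State Q) :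
    project q v (ψ + φ) = project q v ψ + project q v φ := by
  funext s; by_cases h : s q = v <;> simp [project, h]

lemma normSq_smul {Q : Type} [Fintype Q] [DecidableEq Q] (z : ℂ) (ψ : State Q) :
    normSq (z • ψ) = ‖z‖ₑ ^ 2 * normSq ψ := by
  simp [normSq, Finset.mul_sum, enorm_mul, mul_pow]

/-- Young's inequality `|x + y|² ≤ (1 + 1/2)|x|² + (1 + 2)|y|²`, doubled to keep integer
coefficients; after the triangle inequality the slack is `(|x| - 2|y|)²`. The smaller weight goes to
the main term `x`, the larger to the perturbation `y`. -/
lemma two_mul_enorm_add_sq_le (x y : ℂ) :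
    2 * ‖x + y‖ₑ ^ 2 ≤ 3 * ‖x‖ₑ ^ 2 + 6 * ‖y‖ₑ ^ 2 := by
  have h : 2 * ‖x + y‖₊ ^ 2 ≤ 3 * ‖x‖₊ ^ 2 + 6 * ‖y‖₊ ^ 2 := by
    rw [← NNReal.coe_le_coe]
    push_cast
    have h1 := norm_add_le x y
    have h2 : ‖x + y‖ ^ 2 ≤ (‖x‖ + ‖y‖) ^ 2 := by gcongr
    nlinarith [sq_nonneg (‖x‖ - 2 * ‖y‖)]
  simp only [enorm_eq_nnnorm]
  exact_mod_cast h

lemma two_mul_normSq_add_le {Q : Type} [Fintype Q] [DecidableEq Q] (ψ φ : State Q) :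
    2 * normSq (ψ + φ) ≤ 3 * normSq ψ + 6 * normSq φ := by
  simp only [normSq, Finset.mul_sum, ← Finset.sum_add_distrib]
  exact Finset.sum_le_sum fun s _ => two_mul_enorm_add_sq_le _ _

lemma weight_smul {d b c : ℕ} {α : Type} (f : Vec d → ℝ) (P : QProg d b c α) (z : ℂ)
    (ψ : State (Wire d b c)) (a : α) :
    P.weight f (z • ψ) a = ‖z‖ₑ ^ 2 * P.weight f ψ a := by
  induction P generalizing ψ with
  | ret a' => simp only [QProg.weight, normSq_smul]; split <;> simp
  | gate g k ih => simp only [QProg.weight, Gate.apply_smul, ih]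
  | query inv x h η k ih =>
    simp only [QProg.weight]
    rw [← ih]; rfl
  | meas q k ih => simp only [QProg.weight, project_smul, ih, Finset.mul_sum]

/-- Gates, oracle calls and projections act linearly, so the quadratic inequality for squared norms
at the leaves passes through the whole program, adaptive measurements included. -/
lemma two_mul_weight_add_le {d b c : ℕ} {α : Type} (f : Vec d → ℝ) (P : QProg d b c α)
    (ψ φ : State (Wire d b c)) (a : α) :
    2 * P.weight f (ψ + φ) a ≤ 3 * P.weight f ψ a + 6 * P.weight f φ a := by
  induction P generalizing ψ φ with
  | ret a' =>
    simp only [QProg.weight]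
    split
    · exact two_mul_normSq_add_le ψ φ
    · simp
  | gate g k ih => simp only [QProg.weight, Gate.apply_add]; exact ih _ _
  | query inv x h η k ih => simp only [QProg.weight]; exact ih _ _
  | meas q k ih =>
    simp only [QProg.weight, project_add, Finset.mul_sum, ← Finset.sum_add_distrib]
    exact Finset.sum_le_sum fun v _ => ih v _ _

/-- The expectation of `g` under the (unnormalized) outcome weights. -/
noncomputable def QProg.expect {d b c : ℕ} {α : Type} (f : Vec d → ℝ) (P : QProg d b c α)
    (ψ : State (Wire d b c)) (g : α → ℝ≥0∞) : ℝ≥0∞ :=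
  ∑' a, P.weight f ψ a * g a

lemma expect_smul {d b c : ℕ} {α : Type} (f : Vec d → ℝ) (P : QProg d b c α) (z : ℂ)
    (ψ : State (Wire d b c)) (g : α → ℝ≥0∞) :
    P.expect f (z • ψ) g = ‖z‖ₑ ^ 2 * P.expect f ψ g := by
  simp only [QProg.expect, weight_smul, mul_assoc, ENNReal.tsum_mul_left]

/-- The stability estimate: for a test function bounded by one, the perturbation enters only through
its squared norm, because the program preserves total weight. -/
lemma two_mul_expect_add_le {d b c : ℕ} {α : Type} (f : Vec d → ℝ) (P : QProg d b c α)
    (ψ φ : State (Wire d b c)) (g : α → ℝ≥0∞) (hg : ∀ a, g a ≤ 1) :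
    2 * P.expect f (ψ + φ) g ≤ 3 * P.expect f ψ g + 6 * normSq φ := by
  rw [← P.tsum_weight f φ]
  simp only [QProg.expect, ← ENNReal.tsum_mul_left, ← ENNReal.tsum_add]
  refine ENNReal.tsum_le_tsum fun a => ?_
  calc 2 * (P.weight f (ψ + φ) a * g a) = 2 * P.weight f (ψ + φ) a * g a := by ring
    _ ≤ (3 * P.weight f ψ a + 6 * P.weight f φ a) * g a := by
        gcongr; exact two_mul_weight_add_le f P ψ φ a
    _ = 3 * (P.weight f ψ a * g a) + 6 * P.weight f φ a * g a := by ring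
    _ ≤ _ := by
        exact add_le_add le_rfl ((mul_le_mul' le_rfl (hg a)).trans_eq (mul_one _))

lemma expect_ret {d b c : ℕ} {α : Type} (f : Vec d → ℝ) (a : α)
    (ψ : State (Wire d b c)) (g : α → ℝ≥0∞) :
    (QProg.ret a : QProg d b c α).expect f ψ g = normSq ψ * g a := by
  rw [QProg.expect, tsum_eq_single a]
  · simp [QProg.weight]
  · intro a' h
    simp [QProg.weight, h]

lemma expect_gate {d b c : ℕ} {α : Type} (f : Vec d → ℝ) (e : Gate (Wire d b c))
    (k : QProg d b c α) (ψ : State (Wire d b c)) (g : α → ℝ≥0∞) :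
    (QProg.gate e k).expect f ψ g = k.expect f (e.apply ψ) g := rfl

lemma expect_query {d b c : ℕ} {α : Type} (f : Vec d → ℝ) (inv : Bool) (x : Vec d) (h η : ℝ)
    (k : QProg d b c α) (ψ : State (Wire d b c)) (g : α → ℝ≥0∞) :
    (QProg.query inv x h η k).expect f ψ g = k.expect f (oracleApply f inv x h η ψ) g := rfl

lemma expect_runGates {d b c : ℕ} {α : Type} (f : Vec d → ℝ) (gs : List (Gate (Wire d b c)))
    (k : QProg d b c α) (ψ : State (Wire d b c)) (g : α → ℝ≥0∞) :
    (runGates gs k).expect f ψ g = k.expect f (applyGates gs ψ) g := by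
  simp only [QProg.expect, weight_runGates]

lemma expect_meas {d b c : ℕ} {α : Type} (f : Vec d → ℝ) (q : Wire d b c)
    (k : Fin 2 → QProg d b c α) (ψ : State (Wire d b c)) (g : α → ℝ≥0∞) :
    (QProg.meas q k).expect f ψ g = ∑ v, (k v).expect f (project q v ψ) g := by
  simp only [QProg.expect, QProg.weight, Finset.sum_mul]
  exact Summable.tsum_finsetSum fun _ _ => ENNReal.summable

/-! ### Product states -/

/-- The product of the single-qubit states `φ q`. -/
noncomputable def prodState {Q : Type} [Fintype Q] (φ : Q → Fin 2 → ℂ) : State Q :=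
  fun s => ∏ q, φ q (s q)

/-- The qubit state `2^{-1/2} (|0⟩ + e^{2πiθ} |1⟩)`. -/
noncomputable def phaseQubit (θ : ℝ) : Fin 2 → ℂ := fun v =>
  ((1 / Real.sqrt 2 : ℝ) : ℂ) * Complex.exp ((2 * Real.pi * θ * (v : ℕ) : ℝ) * Complex.I)

/-- All single-qubit states are normalized. -/
def IsNormalized {Q : Type} (φ : Q → Fin 2 → ℂ) : Prop := ∀ q, ∑ v, ‖φ q v‖ₑ ^ 2 = 1

section
variable {Q : Type} [Fintype Q] [DecidableEq Q]

lemma prodState_eq_mul_erase (φ : Q → Fin 2 → ℂ) (q : Q) (s : Q → Fin 2) :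
    prodState φ s = φ q (s q) * ∏ p ∈ Finset.univ.erase q, φ p (s p) :=
  (Finset.mul_prod_erase _ (fun p => φ p (s p)) (Finset.mem_univ q)).symm

lemma prodState_apply_update (φ : Q → Fin 2 → ℂ) (q : Q) (s : Q → Fin 2) (v : Fin 2) :
    prodState φ (Function.update s q v) = φ q v * ∏ p ∈ Finset.univ.erase q, φ p (s p) := by
  rw [prodState_eq_mul_erase φ q, Function.update_self]
  congr 1
  refine Finset.prod_congr rfl fun p hp => ?_
  rw [Function.update_of_ne (Finset.ne_of_mem_erase hp)]

lemma prodState_update_apply (φ : Q → Fin 2 → ℂ) (q : Q) (s : Q → Fin 2) (χ : Fin 2 → ℂ) :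
    prodState (Function.update φ q χ) s = χ (s q) * ∏ p ∈ Finset.univ.erase q, φ p (s p) := by
  rw [prodState_eq_mul_erase _ q, Function.update_self]
  congr 1
  refine Finset.prod_congr rfl fun p hp => ?_
  rw [Function.update_of_ne (Finset.ne_of_mem_erase hp)]

lemma hadamard_prodState (φ : Q → Fin 2 → ℂ) (q : Q) :
    (Gate.hadamard q).apply (prodState φ) = prodState (Function.update φ q fun v =>
      ((1 / Real.sqrt 2 : ℝ) : ℂ) * (φ q 0 + (-1) ^ (v : ℕ) * φ q 1)) := by
  funext s
  simp only [Gate.apply, prodState_apply_update, prodState_update_apply]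
  ring

lemma phase_prodState (φ : Q → Fin 2 → ℂ) (q : Q) (θ : ℝ) :
    (Gate.phase q θ).apply (prodState φ) = prodState (Function.update φ q fun v =>
      Complex.exp (θ * (v : ℕ) * Complex.I) * φ q v) := by
  funext s
  simp only [Gate.apply, prodState_update_apply, prodState_eq_mul_erase φ q]
  ring

lemma project_prodState (φ : Q → Fin 2 → ℂ) (q : Q) (v : Fin 2) :
    project q v (prodState φ) =
      φ q v • prodState (Function.update φ q (Pi.single v 1)) := by
  funext s
  simp only [project, Pi.smul_apply, smul_eq_mul, prodState_update_apply,
    prodState_eq_mul_erase φ q]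
  by_cases h : s q = v
  · simp [h]
  · simp [h]

lemma normSq_prodState (φ : Q → Fin 2 → ℂ) (h : IsNormalized φ) : normSq (prodState φ) = 1 := by
  have : normSq (prodState φ) = ∏ q, ∑ v, ‖φ q v‖ₑ ^ 2 := by
    rw [Finset.prod_univ_sum, normSq, Fintype.piFinset_univ]
    refine Finset.sum_congr rfl fun s _ => ?_
    rw [prodState, Finset.prod_pow]
    congr 1
    simp only [enorm_eq_nnnorm, nnnorm_prod]
    push_cast
    rfl
  rw [this]
  exact Finset.prod_eq_one fun q _ => h q

lemma zeroState_eq_prodState : zeroState Q = prodState fun _ => Pi.single 0 1 := by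
  funext s
  by_cases h : s = fun _ => 0
  · simp [zeroState, prodState, h]
  · obtain ⟨q, hq⟩ : ∃ q, s q ≠ 0 := by
      by_contra! h'
      exact h (funext h')
    rw [zeroState, if_neg h, prodState_eq_mul_erase _ q]
    simp [hq]

end

lemma sum_enorm_single (v : Fin 2) : ∑ w, ‖(Pi.single v 1 : Fin 2 → ℂ) w‖ₑ ^ 2 = 1 := by
  fin_cases v <;> simp [Fin.sum_univ_two]

lemma enorm_phaseQubit_sq (θ : ℝ) (v : Fin 2) : ‖phaseQubit θ v‖ₑ ^ 2 = ENNReal.ofReal (1 / 2) := by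
  have h : ‖phaseQubit θ v‖ ^ 2 = 1 / 2 := by
    rw [phaseQubit, norm_mul, Complex.norm_exp_ofReal_mul_I, mul_one, Complex.norm_real,
      Real.norm_eq_abs, sq_abs, div_pow, one_pow, Real.sq_sqrt (by norm_num)]
  rw [← h, ← ofReal_norm, ENNReal.ofReal_pow (norm_nonneg _)]

lemma sum_enorm_phaseQubit (θ : ℝ) : ∑ v, ‖phaseQubit θ v‖ₑ ^ 2 = 1 := by
  rw [Fin.sum_univ_two, enorm_phaseQubit_sq, enorm_phaseQubit_sq,
    ← ENNReal.ofReal_add (by norm_num) (by norm_num)]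
  norm_num

lemma IsNormalized.update {Q : Type} [DecidableEq Q] {φ : Q → Fin 2 → ℂ} (h : IsNormalized φ) (q : Q)
    {χ : Fin 2 → ℂ} (hχ : ∑ v, ‖χ v‖ₑ ^ 2 = 1) : IsNormalized (Function.update φ q χ) := by
  intro p
  by_cases hp : p = q
  · subst hp; simpa using hχ
  · simpa [hp] using h p

/-- Gates acting on one qubit each, performed qubit after qubit on a product state. -/
lemma applyGates_flatMap_prodState {Q ι : Type} [Fintype Q] [DecidableEq Q] (w : ι → Q)
    (hw : Function.Injective w) (gs : ι → List (Gate Q)) (χ χ' : ι → Fin 2 → ℂ)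
    (hgs : ∀ i φ, φ (w i) = χ i → applyGates (gs i) (prodState φ) =
      prodState (Function.update φ (w i) (χ' i)))
    (l : List ι) (hl : l.Nodup) (φ : Q → Fin 2 → ℂ) (hφ : ∀ i ∈ l, φ (w i) = χ i) :
    ∃ φ', applyGates (l.flatMap gs) (prodState φ) = prodState φ' ∧
      (∀ i ∈ l, φ' (w i) = χ' i) ∧ ∀ q, (∀ i ∈ l, w i ≠ q) → φ' q = φ q := by
  induction l generalizing φ with
  | nil => exact ⟨φ, rfl, by simp, by simp⟩
  | cons i l ih =>
    obtain ⟨hi, hl⟩ := List.nodup_cons.mp hl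
    obtain ⟨φ', h1, h2, h3⟩ := ih hl (Function.update φ (w i) (χ' i)) fun j hj => by
      have hij : w j ≠ w i := fun h => hi ((hw h) ▸ hj)
      rw [Function.update_of_ne hij]
      exact hφ j (List.mem_cons_of_mem _ hj)
    refine ⟨φ', ?_, ?_, ?_⟩
    · rw [List.flatMap_cons, applyGates_append, hgs i φ (hφ i List.mem_cons_self), h1]
    · intro j hj
      rcases List.mem_cons.mp hj with rfl | hj
      · have hij : ∀ k ∈ l, w k ≠ w j := fun k hk h => hi ((hw h) ▸ hk)
        rw [h3 _ hij, Function.update_self]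
      · exact h2 j hj
    · intro q hq
      rw [h3 q fun j hj => hq j (List.mem_cons_of_mem _ hj),
        Function.update_of_ne (hq i List.mem_cons_self).symm]

/-! ### The adder -/

/-- The number in binary on a list of wires, least significant first. -/
def listNum {Q : Type} : List Q → (Q → Fin 2) → ℕ
  | [], _ => 0
  | q :: qs, s => (s q : ℕ) + 2 * listNum qs s

lemma listNum_congr {Q : Type} (l : List Q) (s s' : Q → Fin 2) (h : ∀ q ∈ l, s q = s' q) :
    listNum l s = listNum l s' := by
  induction l with
  | nil => rfl
  | cons q l ih =>
    rw [listNum, listNum, h q List.mem_cons_self, ih fun p hp => h p (List.mem_cons_of_mem _ hp)]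

lemma listNum_map_finRange {Q : Type} (n : ℕ) (w : Fin n → Q) (s : Q → Fin 2) :
    listNum ((List.finRange n).map w) s = ∑ j, (s (w j) : ℕ) * 2 ^ (j : ℕ) := by
  induction n with
  | zero => rfl
  | succ n ih =>
    rw [List.finRange_succ, List.map_cons, List.map_map, listNum, ih, Fin.sum_univ_succ,
      Finset.mul_sum]
    congr 1
    · simp
    · refine Finset.sum_congr rfl fun j _ => ?_
      simp only [Function.comp, Fin.val_succ, pow_succ]
      ring

lemma fin_two_cases (a : Fin 2) : a = 0 ∨ a = 1 := by
  fin_cases a <;> simp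

lemma flipIf_cnot {Q : Type} [DecidableEq Q] {a t : Q} (h : a ≠ t) (s : Q → Fin 2) :
    flipIf (a ≠ t ∧ s a = 1) t s = Function.update s t (s t + s a) := by
  rcases fin_two_cases (s a) with ha | ha <;> simp [flipIf, h, ha]

lemma flipIf_toffoli {Q : Type} [DecidableEq Q] {a a' t : Q} (h : a ≠ t) (h' : a' ≠ t)
    (s : Q → Fin 2) :
    flipIf (a ≠ t ∧ a' ≠ t ∧ s a = 1 ∧ s a' = 1) t s =
      Function.update s t (s t + s a * s a') := by
  rcases fin_two_cases (s a) with ha | ha <;> rcases fin_two_cases (s a') with ha' | ha' <;>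
    simp [flipIf, h, h', ha, ha']

/-- The full-adder identity, read backwards from the sum bit `υ`: the original bit is `υ + ζ + π`,
and the outgoing carry is the majority of that bit, the addend `π` and the carry `ζ`. -/
lemma adder_bits (ζ π υ : Fin 2) :
    ((υ + ζ + π : Fin 2) : ℕ) + π + ζ = υ + 2 * ((π + (ζ + π) * (υ + ζ) : Fin 2) : ℕ) := by
  revert ζ π υ; decide

/-- The adder permutes the basis states; the preimage of a basis state has `y - p - z` on the
wires `y`. -/
lemma applyGates_adder {Q : Type} [DecidableEq Q] (l : List (Q × Q)) (z : Q)
    (hl : (z :: (l.map Prod.fst ++ l.map Prod.snd)).Nodup) :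
    ∃ σ : (Q → Fin 2) → (Q → Fin 2), (∀ ψ, applyGates (adder l z) ψ = fun s => ψ (σ s)) ∧
      ∀ s, (∀ q ∉ l.map Prod.snd, σ s q = s q) ∧
        listNum (l.map Prod.snd) (σ s) + listNum (l.map Prod.fst) s + s z ≡
          listNum (l.map Prod.snd) s [MOD 2 ^ l.length] := by
  induction l generalizing z with
  | nil => exact ⟨id, fun ψ => rfl, fun s => ⟨fun q _ => rfl, by simp [Nat.modEq_one]⟩⟩
  | cons py l ih =>
    obtain ⟨p, y⟩ := py
    simp only [List.map_cons, List.cons_append, List.nodup_cons, List.mem_cons, List.mem_append,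
      not_or, List.nodup_append] at hl
    obtain ⟨⟨hzp, hzf, hzy, hzs⟩, ⟨hpf, hpy, hps⟩, hF, ⟨hys, hS⟩, hFS⟩ := hl
    have hyF : y ∉ l.map Prod.fst := fun h => hFS y h y (Or.inl rfl) rfl
    obtain ⟨σ, hσ, hσ'⟩ := ih p (by
      simp only [List.nodup_cons, List.mem_append, not_or, List.nodup_append]
      exact ⟨⟨hpf, hps⟩, hF, hS, fun a ha b hb => hFS a ha b (Or.inr hb)⟩)
    set C : Q → Q → (Q → Fin 2) → (Q → Fin 2) := fun a t s => Function.update s t (s t + s a)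
      with hC
    set T : Q → Q → Q → (Q → Fin 2) → (Q → Fin 2) := fun a a' t s =>
      Function.update s t (s t + s a * s a') with hT
    refine ⟨fun s => C p y (C p z (T z y p (σ (T z y p (C p z (C z y s)))))), ?_, ?_⟩
    · intro ψ
      rw [adder, applyGates_append, applyGates_append, hσ]
      funext s
      simp only [applyGates, List.foldl, Gate.apply]
      rw [flipIf_cnot hzy, flipIf_cnot (Ne.symm hzp), flipIf_toffoli hzp (Ne.symm hpy),
        flipIf_toffoli hzp (Ne.symm hpy), flipIf_cnot (Ne.symm hzp), flipIf_cnot hpy]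
    · intro s
      -- Preimages are followed from the last gate back: `s'` is the state just after the recursive
      -- adder, `s''` the state just before it, and `t` below the state before the first three
      -- gates. On `s'` the wire `p` holds the carry into the next position, as `e3` records.
      set s' := T z y p (C p z (C z y s)) with hs'
      have e1 : s' z = s z + s p := by
        simp [hs', hC, hT, hzp, hzy, hpy]
      have e2 : s' y = s y + s z := by
        simp [hs', hC, hT, Ne.symm hzy, Ne.symm hpy]
      have e3 : s' p = s p + (s z + s p) * (s y + s z) := by
        simp [hs', hC, hT, hzy, Ne.symm hzp, Ne.symm hzy, hpy]
      have e4 : ∀ q, q ≠ z → q ≠ y → q ≠ p → s' q = s q := fun q h1 h2 h3 => by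
        simp [hs', hC, hT, h1, h2, h3]
      obtain ⟨hσ1, hσ2⟩ := hσ' s'
      set s'' := σ s' with hs''
      have f1 : s'' z = s' z := hσ1 z hzs
      have f2 : s'' y = s' y := hσ1 y hys
      have f3 : s'' p = s' p := hσ1 p hps
      set t := C p y (C p z (T z y p s'')) with ht
      have xx : ∀ a b : Fin 2, a + b + b = a := by decide
      have g1 : t p = s p := by
        have : t p = s'' p + s'' z * s'' y := by
          simp [ht, hC, hT, Ne.symm hzp, hpy]
        rw [this, f1, f2, f3, e1, e2, e3, xx]
      have g2 : t z = s z := by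
        have : t z = s'' z + (s'' p + s'' z * s'' y) := by
          simp [ht, hC, hT, hzp, hzy]
        rw [this, f1, f2, f3, e1, e2, e3, xx, xx]
      have g3 : t y = s y + s z + s p := by
        have : t y = s'' y + (s'' p + s'' z * s'' y) := by
          simp [ht, hC, hT, Ne.symm hzp, Ne.symm hzy, Ne.symm hpy]
        rw [this, f1, f2, f3, e1, e2, e3, xx]
      have g4 : ∀ q, q ≠ z → q ≠ y → q ≠ p → t q = s'' q := fun q h1 h2 h3 => by
        simp [ht, hC, hT, h1, h2, h3]
      change (∀ q ∉ ((p, y) :: l).map Prod.snd, t q = s q) ∧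
        listNum (((p, y) :: l).map Prod.snd) t + listNum (((p, y) :: l).map Prod.fst) s + s z ≡
          listNum (((p, y) :: l).map Prod.snd) s [MOD 2 ^ ((p, y) :: l).length]
      refine ⟨?_, ?_⟩
      · intro q hq
        simp only [List.map_cons, List.mem_cons, not_or] at hq
        by_cases hqz : q = z
        · rw [hqz, g2]
        by_cases hqp : q = p
        · rw [hqp, g1]
        rw [g4 q hqz hq.1 hqp, hσ1 q hq.2, e4 q hqz hq.1 hqp]
      · have n1 : listNum (l.map Prod.snd) t = listNum (l.map Prod.snd) s'' :=
          listNum_congr _ _ _ fun q hq => g4 q (fun h => hzs (h ▸ hq)) (fun h => hys (h ▸ hq))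
            (fun h => hps (h ▸ hq))
        have n2 : listNum (l.map Prod.snd) s' = listNum (l.map Prod.snd) s :=
          listNum_congr _ _ _ fun q hq => e4 q (fun h => hzs (h ▸ hq)) (fun h => hys (h ▸ hq))
            (fun h => hps (h ▸ hq))
        have n3 : listNum (l.map Prod.fst) s' = listNum (l.map Prod.fst) s :=
          listNum_congr _ _ _ fun q hq => e4 q (fun h => hzf (h ▸ hq)) (fun h => hyF (h ▸ hq))
            (fun h => hpf (h ▸ hq))
        rw [n2, n3, e3] at hσ2
        have hb := adder_bits (s z) (s p) (s y)
        simp only [List.map_cons, listNum, n1, g3, List.length_cons, pow_succ']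
        have h2 := (hσ2.mul_left' 2).add_left (s y : ℕ)
        refine (congrArg (· ≡ (s y : ℕ) + 2 * listNum (l.map Prod.snd) s
          [MOD 2 * 2 ^ l.length]) ?_).mpr h2
        omega

lemma zmod_finEquiv_eq_cast (n : ℕ) [NeZero n] (x : Fin n) :
    ZMod.finEquiv n x = ((x : ℕ) : ZMod n) := by
  cases n with
  | zero => exact absurd rfl (NeZero.ne 0)
  | succ n => exact (Fin.cast_val_eq_self x).symm

lemma wordEquiv_eq_cast (c : ℕ) (w : Fin c → Fin 2) :
    wordEquiv c w = ((∑ j, (w j : ℕ) * 2 ^ (j : ℕ) : ℕ) : ZMod (2 ^ c)) := by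
  have h : wordEquiv c w = ZMod.finEquiv (2 ^ c) (finFunctionFinEquiv w) := rfl
  rw [h, zmod_finEquiv_eq_cast, finFunctionFinEquiv_apply]

/-! ### The squared Fejér-type kernel `∏ cos²(2^j y)` -/

/-- The probability that phase estimation with `n` qubits and phase `y / π` yields zero. -/
noncomputable def cosProd (n : ℕ) (y : ℝ) : ℝ := ∏ j ∈ Finset.range n, Real.cos (2 ^ j * y) ^ 2

lemma cosProd_nonneg (n : ℕ) (y : ℝ) : 0 ≤ cosProd n y :=
  Finset.prod_nonneg fun _ _ => sq_nonneg _

/-- The duplication formula for the sine telescopes the product of cosines. The multiplied form also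
holds where `sin y = 0`. -/
lemma cosProd_mul_sin_sq (n : ℕ) (y : ℝ) :
    cosProd n y * ((2 ^ n) ^ 2 * Real.sin y ^ 2) = Real.sin (2 ^ n * y) ^ 2 := by
  induction n with
  | zero => simp [cosProd]
  | succ n ih =>
    have h : (2 : ℝ) ^ (n + 1) * y = 2 * (2 ^ n * y) := by ring
    rw [cosProd, Finset.prod_range_succ, ← cosProd, h, Real.sin_two_mul, pow_succ]
    linear_combination 4 * Real.cos (2 ^ n * y) ^ 2 * ih

lemma cosProd_le (n : ℕ) (y : ℝ) (hy : Real.sin y ≠ 0) :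
    cosProd n y ≤ 1 / ((2 ^ n) ^ 2 * Real.sin y ^ 2) := by
  rw [le_div_iff₀ (by positivity), cosProd_mul_sin_sq]
  exact Real.sin_sq_le_one _

lemma sum_range_two_mul {M : Type*} [AddCommMonoid M] (n : ℕ) (F : ℕ → M) :
    ∑ x ∈ Finset.range (2 * n), F x = ∑ x ∈ Finset.range n, (F (2 * x) + F (2 * x + 1)) := by
  induction n with
  | zero => simp
  | succ n ih =>
    rw [mul_add, mul_one, Finset.sum_range_succ, Finset.sum_range_succ, ih,
      Finset.sum_range_succ, add_assoc]

lemma cos_sub_nat_mul_pi_sq (α : ℝ) (n : ℕ) :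
    Real.cos (α - n * Real.pi) ^ 2 = Real.cos α ^ 2 := by
  rw [Real.cos_sub_nat_mul_pi, mul_pow, ← pow_mul, mul_comm n 2, pow_mul]
  simp

lemma cos_sub_half_pi_sq (α : ℝ) :
    Real.cos (α - Real.pi / 2) ^ 2 = Real.sin α ^ 2 := by
  rw [Real.cos_sub_pi_div_two]

/-- The outcomes are split by their lowest bit. Up to a multiple of `π`, the highest cosine factor
sees only this bit, so the two halves carry total weights `cos²` and `sin²` of the same angle. -/
lemma sum_cosProd (n : ℕ) (y : ℝ) :
    ∑ x ∈ Finset.range (2 ^ n), cosProd n (y - Real.pi * x / 2 ^ n) = 1 := by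
  induction n generalizing y with
  | zero => simp [cosProd]
  | succ n ih =>
    rw [pow_succ', sum_range_two_mul, Finset.sum_add_distrib]
    have key : ∀ (v x : ℕ), cosProd (n + 1) (y - Real.pi * ((2 * x + v : ℕ) : ℝ) / 2 ^ (n + 1)) =
        Real.cos (2 ^ n * y - Real.pi / 2 * v) ^ 2 *
          cosProd n (y - Real.pi / 2 ^ (n + 1) * v - Real.pi * x / 2 ^ n) := by
      intro v x
      rw [cosProd, Finset.prod_range_succ, ← cosProd, mul_comm]
      congr 1
      · rw [← cos_sub_nat_mul_pi_sq (2 ^ n * y - Real.pi / 2 * v) x]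
        congr 2
        push_cast
        field_simp
        ring
      · congr 1
        push_cast
        field_simp
        ring
    have h0 := fun x => key 0 x
    have h1 := fun x => key 1 x
    simp only [add_zero] at h0
    simp only [h0, h1, ← Finset.mul_sum, ih]
    simp only [Nat.cast_zero, mul_zero, sub_zero, Nat.cast_one, mul_one, cos_sub_half_pi_sq]
    rw [add_comm, Real.sin_sq_add_cos_sq]

/-! ### Tail bound -/

/-- The difference of cotangents equals `sin 2h / (sin (a - h) sin (a + h))`, and `sin (a - h) sin
(a + h) = sin² a - sin² h ≤ sin² a`. Over a grid of spacing `2h` the right side telescopes. -/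
lemma one_div_sin_sq_le {a h : ℝ} (h0 : 0 < h) (ha : h < a)
    (ha' : a < Real.pi - h) :
    1 / Real.sin a ^ 2 ≤ (Real.cot (a - h) - Real.cot (a + h)) / Real.sin (2 * h) := by
  have s1 : 0 < Real.sin (a - h) := Real.sin_pos_of_pos_of_lt_pi (by linarith) (by linarith)
  have s2 : 0 < Real.sin (a + h) := Real.sin_pos_of_pos_of_lt_pi (by linarith) (by linarith)
  have s3 : 0 < Real.sin a := Real.sin_pos_of_pos_of_lt_pi (by linarith) (by linarith)
  have s4 : 0 < Real.sin (2 * h) := Real.sin_pos_of_pos_of_lt_pi (by linarith) (by linarith)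
  have e1 : Real.cot (a - h) - Real.cot (a + h) =
      Real.sin (2 * h) / (Real.sin (a - h) * Real.sin (a + h)) := by
    rw [Real.cot_eq_cos_div_sin, Real.cot_eq_cos_div_sin, div_sub_div _ _ s1.ne' s2.ne']
    congr 1
    have : 2 * h = (a + h) - (a - h) := by ring
    rw [this, Real.sin_sub (a + h) (a - h)]
    ring
  have e2 : Real.sin (a - h) * Real.sin (a + h) = Real.sin a ^ 2 - Real.sin h ^ 2 := by
    rw [Real.sin_sub, Real.sin_add]
    have := Real.sin_sq_add_cos_sq a
    have := Real.sin_sq_add_cos_sq h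
    nlinarith
  rw [e1, div_div, mul_comm _ (Real.sin (2 * h)), ← div_div, div_self s4.ne']
  apply one_div_le_one_div_of_le (mul_pos s1 s2)
  rw [e2]
  nlinarith [sq_nonneg (Real.sin h)]

lemma cot_le_cot {x y : ℝ} (hx : 0 < x) (hxy : x ≤ y) (hy : y < Real.pi) :
    Real.cot y ≤ Real.cot x := by
  have s1 : 0 < Real.sin x := Real.sin_pos_of_pos_of_lt_pi hx (by linarith)
  have s2 : 0 < Real.sin y := Real.sin_pos_of_pos_of_lt_pi (by linarith) hy
  rw [Real.cot_eq_cos_div_sin, Real.cot_eq_cos_div_sin, div_le_div_iff₀ s2 s1]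
  have := Real.sin_nonneg_of_nonneg_of_le_pi (x := y - x) (by linarith) (by linarith)
  rw [Real.sin_sub] at this
  linarith

lemma cot_le_one_div {x : ℝ} (hx : 0 < x) (hx' : x < Real.pi / 2) : Real.cot x ≤ 1 / x := by
  have h := Real.lt_tan hx hx'
  rw [← Real.tan_inv_eq_cot, ← one_div]
  exact one_div_le_one_div_of_le hx h.le

/-- Bound for the sum of the squared cosecants at the points at distance more than `k` from the multiples of
`N`. -/
lemma sum_one_div_sin_sq_le {N k θ : ℝ} (hk : 1 ≤ k) (hN : 4 * k ≤ N) (S : Finset ℤ)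
    (hS : ∀ j ∈ S, k < j - θ ∧ j - θ < N - k) :
    ∑ j ∈ S, 1 / (N ^ 2 * Real.sin (Real.pi * (j - θ) / N) ^ 2) ≤
      1 / (Real.pi * (k - 1 / 2)) := by
  have hN0 : 0 < N := by linarith
  have hpi := Real.pi_pos
  set h : ℝ := Real.pi / (2 * N) with hh
  have h0 : 0 < h := by positivity
  have h2 : h < Real.pi / 2 := by
    rw [hh, div_lt_div_iff₀ (by positivity) (by norm_num)]
    nlinarith
  have s0 : 0 < Real.sin (2 * h) := Real.sin_pos_of_pos_of_lt_pi (by linarith) (by linarith)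
  -- Concavity of the sine on `[0, π/2]`: `sin x ≥ 2x/π`, with `x = 2h = π/N`.
  have hs : 2 / N ≤ Real.sin (2 * h) := by
    have := Real.mul_le_sin (x := 2 * h) (by linarith) (by
      rw [hh, show 2 * (Real.pi / (2 * N)) = Real.pi / N by field_simp,
        div_le_div_iff₀ hN0 (by norm_num)]
      nlinarith)
    rw [hh] at this ⊢
    convert this using 1
    field_simp
  set Φ : ℤ → ℝ := fun j => Real.cot (Real.pi * (j - θ - 1 / 2) / N) with hΦ
  set y : ℝ := Real.pi * (k - 1 / 2) / N with hy
  have y0 : 0 < y := by rw [hy]; apply div_pos _ hN0; apply mul_pos hpi; linarith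
  have y1 : y < Real.pi / 2 := by
    rw [hy, div_lt_div_iff₀ hN0 (by norm_num)]
    nlinarith
  have term : ∀ j : ℤ, k < j - θ → j - θ < N - k →
      1 / (N ^ 2 * Real.sin (Real.pi * (j - θ) / N) ^ 2) ≤
        1 / (N ^ 2 * Real.sin (2 * h)) * (Φ j - Φ (j + 1)) := by
    intro j h1 h2'
    have a1 : h < Real.pi * (j - θ) / N := by
      rw [hh, div_lt_div_iff₀ (by positivity) hN0]
      nlinarith [mul_pos hpi hN0, mul_pos (mul_pos hpi hN0) (by linarith : 0 < (j:ℝ) - θ - 1/2)]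
    have a2 : Real.pi * (j - θ) / N < Real.pi - h := by
      have : Real.pi - h = Real.pi * (N - 1 / 2) / N := by rw [hh]; field_simp
      rw [this, div_lt_div_iff_of_pos_right hN0]
      nlinarith
    have := one_div_sin_sq_le h0 a1 a2
    have b1 : Real.pi * (j - θ) / N - h = Real.pi * (j - θ - 1 / 2) / N := by
      rw [hh]; field_simp
    have b2 : Real.pi * (j - θ) / N + h = Real.pi * (((j + 1 : ℤ) : ℝ) - θ - 1 / 2) / N := by
      rw [hh]; push_cast; field_simp; ring
    rw [b1, b2] at this
    calc 1 / (N ^ 2 * Real.sin (Real.pi * (j - θ) / N) ^ 2)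
        = 1 / N ^ 2 * (1 / Real.sin (Real.pi * (j - θ) / N) ^ 2) := by
          rw [one_div_mul_one_div]
      _ ≤ 1 / N ^ 2 * ((Φ j - Φ (j + 1)) / Real.sin (2 * h)) := by
          apply mul_le_mul_of_nonneg_left this (by positivity)
      _ = _ := by field_simp
  have cot_y : Real.cot y ≤ N / (Real.pi * (k - 1 / 2)) := by
    refine (cot_le_one_div y0 y1).trans_eq ?_
    rw [hy, one_div_div]
  have hkpos : 0 < Real.pi * (k - 1 / 2) := mul_pos hpi (by linarith)
  -- the points form part of an integer interval, over which the bounds telescope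
  set A : ℤ := ⌊θ + k⌋ + 1 with hA
  set B : ℤ := ⌈θ + N - k⌉ with hB
  have hA1 : θ + k < A := by rw [hA]; push_cast; exact Int.lt_floor_add_one _
  have hB1 : (B : ℝ) < θ + N - k + 1 := Int.ceil_lt_add_one _
  have sub : S ⊆ Finset.Ico A B := by
    intro j hj
    obtain ⟨h1, h2⟩ := hS j hj
    rw [Finset.mem_Ico]
    constructor
    · rw [hA, Int.add_one_le_iff, Int.floor_lt]; linarith
    · rw [hB, Int.lt_ceil]; linarith
  have memI : ∀ j ∈ Finset.Ico A B, k < j - θ ∧ j - θ < N - k := by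
    intro j hj
    rw [Finset.mem_Ico] at hj
    have h1 : (A : ℝ) ≤ j := by exact_mod_cast hj.1
    have h2 : (j : ℝ) < θ + N - k := Int.lt_ceil.mp hj.2
    constructor <;> linarith
  have tel : ∀ n : ℕ,
      ∑ j ∈ Finset.Ico A (A + n), (Φ j - Φ (j + 1)) = Φ A - Φ (A + n) := by
    intro n
    induction n with
    | zero => simp
    | succ n ih =>
      have : Finset.Ico A (A + (n + 1 : ℕ)) = insert (A + n) (Finset.Ico A (A + n)) := by
        ext j; simp only [Finset.mem_Ico, Finset.mem_insert]; push_cast; omega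
      rw [this, Finset.sum_insert (by simp), ih]
      push_cast
      rw [← add_assoc]
      ring
  calc ∑ j ∈ S, 1 / (N ^ 2 * Real.sin (Real.pi * (j - θ) / N) ^ 2)
      ≤ ∑ j ∈ Finset.Ico A B, 1 / (N ^ 2 * Real.sin (Real.pi * (j - θ) / N) ^ 2) :=
        Finset.sum_le_sum_of_subset_of_nonneg sub fun _ _ _ => by positivity
    _ ≤ ∑ j ∈ Finset.Ico A B, 1 / (N ^ 2 * Real.sin (2 * h)) * (Φ j - Φ (j + 1)) :=
        Finset.sum_le_sum fun j hj => term j (memI j hj).1 (memI j hj).2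
    _ = 1 / (N ^ 2 * Real.sin (2 * h)) * ∑ j ∈ Finset.Ico A B, (Φ j - Φ (j + 1)) := by
        rw [Finset.mul_sum]
    _ ≤ 1 / (N ^ 2 * Real.sin (2 * h)) * (2 * (N / (Real.pi * (k - 1 / 2)))) := by
        apply mul_le_mul_of_nonneg_left _ (by positivity)
        by_cases hAB : A < B
        · obtain ⟨n, hn⟩ := Int.le.dest hAB.le
          rw [← hn, tel n, hn]
          have c1 : Φ A ≤ Real.cot y := by
            apply cot_le_cot y0
            · rw [hy, div_le_div_iff_of_pos_right hN0]
              nlinarith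
            · rw [div_lt_iff₀ hN0]
              have : (A : ℝ) + 1 ≤ B := by exact_mod_cast hAB
              nlinarith
          -- The right end is reflected by `cot (π - x) = -cot x`, so both ends obey the same bound.
          -- This is the origin of the factor 2 in front of `N / (π(k - 1/2))`.
          have c2 : -Φ B ≤ Real.cot y := by
            have : -Φ B = Real.cot (Real.pi - Real.pi * (B - θ - 1 / 2) / N) := by
              rw [hΦ]; simp only; rw [Real.cot_eq_cos_div_sin, Real.cot_eq_cos_div_sin, Real.cos_pi_sub,
                Real.sin_pi_sub, neg_div]
            rw [this]
            have e : Real.pi - Real.pi * (B - θ - 1 / 2) / N =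
                Real.pi * (N - (B - θ - 1 / 2)) / N := by field_simp
            rw [e]
            have : (A : ℝ) + 1 ≤ B := by exact_mod_cast hAB
            apply cot_le_cot y0
            · rw [hy, div_le_div_iff_of_pos_right hN0]
              nlinarith
            · rw [div_lt_iff₀ hN0]
              nlinarith
          linarith
        · rw [Finset.Ico_eq_empty_of_le (not_lt.mp hAB), Finset.sum_empty]
          positivity
    _ ≤ 1 / (N ^ 2 * (2 / N)) * (2 * (N / (Real.pi * (k - 1 / 2)))) := by
        gcongr
    _ = 1 / (Real.pi * (k - 1 / 2)) := by
        field_simp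

/-- Phase estimation of a phase `θ` that is not close to `0` or `1` errs by more than `k` with
probability at most `1 / (π (k - 1/2))`. -/
lemma sum_cosProd_tail_le (n : ℕ) {k θ : ℝ} (hk : 1 ≤ k) (hN : 4 * k < 2 ^ n)
    (h1 : 1 / 4 ≤ θ) (h2 : θ ≤ 3 / 4) :
    ∑ x ∈ (Finset.range (2 ^ n)).filter (fun x : ℕ => k < |(x : ℝ) - 2 ^ n * θ|),
      cosProd n (Real.pi * (θ - x / 2 ^ n)) ≤ 1 / (Real.pi * (k - 1 / 2)) := by
  set N : ℝ := 2 ^ n with hNdef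
  have hN0 : 0 < N := by positivity
  set S := (Finset.range (2 ^ n)).filter (fun x : ℕ => k < |(x : ℝ) - N * θ|) with hS
  set e : ℕ → ℤ := fun x => if (x : ℝ) < N * θ then x + 2 ^ n else x with he
  have hlt : ∀ x ∈ S, (x : ℝ) < N := by
    intro x hx
    rw [hS, Finset.mem_filter, Finset.mem_range] at hx
    rw [hNdef]; exact_mod_cast hx.1
  have inj : Set.InjOn e S := by
    intro x hx y hy hxy
    have hx' := (Finset.mem_range.mp (Finset.mem_filter.mp hx).1)
    have hy' := (Finset.mem_range.mp (Finset.mem_filter.mp hy).1)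
    have hx'' : (x : ℤ) < 2 ^ n := by exact_mod_cast hx'
    have hy'' : (y : ℤ) < 2 ^ n := by exact_mod_cast hy'
    simp only [he] at hxy
    split_ifs at hxy <;> omega
  -- Here `1/4 ≤ θ ≤ 3/4` and `4k < N` are needed: outcomes near the opposite end of the range must
  -- not come within `k` of `Nθ` modulo `N`.
  have rng : ∀ x ∈ S, k < (e x : ℝ) - N * θ ∧ (e x : ℝ) - N * θ < N - k := by
    intro x hx
    have hxk := (Finset.mem_filter.mp hx).2
    have hxN := hlt x hx
    have hx0 : (0 : ℝ) ≤ x := Nat.cast_nonneg x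
    simp only [he]
    split_ifs with hc
    · rw [abs_of_neg (by linarith)] at hxk
      push_cast
      rw [← hNdef]
      constructor <;> nlinarith
    · rw [abs_of_nonneg (by linarith)] at hxk
      push_cast
      constructor <;> nlinarith
  have kernel : ∀ x ∈ S, cosProd n (Real.pi * (θ - x / N)) ≤
      1 / (N ^ 2 * Real.sin (Real.pi * ((e x : ℝ) - N * θ) / N) ^ 2) := by
    intro x hx
    obtain ⟨r1, r2⟩ := rng x hx
    have sp : 0 < Real.sin (Real.pi * ((e x : ℝ) - N * θ) / N) := by
      apply Real.sin_pos_of_pos_of_lt_pi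
      · apply div_pos _ hN0; apply mul_pos Real.pi_pos; linarith
      · rw [div_lt_iff₀ hN0]; nlinarith [Real.pi_pos]
    have hsq : Real.sin (Real.pi * ((e x : ℝ) - N * θ) / N) ^ 2 =
        Real.sin (Real.pi * (θ - x / N)) ^ 2 := by
      simp only [he]
      split_ifs with hc
      · have : Real.pi * (((x + 2 ^ n : ℤ) : ℝ) - N * θ) / N =
            Real.pi - Real.pi * (θ - x / N) := by
          push_cast; rw [← hNdef]; field_simp; ring
        rw [this, Real.sin_pi_sub]
      · have : Real.pi * (((x : ℤ) : ℝ) - N * θ) / N = - (Real.pi * (θ - x / N)) := by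
          push_cast; field_simp; ring
        rw [this, Real.sin_neg, neg_sq]
    have hne : Real.sin (Real.pi * (θ - x / N)) ≠ 0 := by
      intro h0
      rw [h0] at hsq
      have := pow_pos sp 2
      rw [hsq] at this
      norm_num at this
    rw [hsq]
    exact cosProd_le n _ hne
  calc _ ≤ ∑ x ∈ S, 1 / (N ^ 2 * Real.sin (Real.pi * ((e x : ℝ) - N * θ) / N) ^ 2) :=
        Finset.sum_le_sum kernel
    _ = ∑ j ∈ S.image e, 1 / (N ^ 2 * Real.sin (Real.pi * ((j : ℝ) - N * θ) / N) ^ 2) := by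
        rw [Finset.sum_image inj]
    _ ≤ _ := by
        apply sum_one_div_sin_sq_le hk hN.le
        intro j hj
        obtain ⟨x, hx, rfl⟩ := Finset.mem_image.mp hj
        exact rng x hx

/-! ### The semiclassical Fourier transform on product states -/

/-- The amplitude is `(1 + e^{2iα})/2 = e^{iα} cos α`, where `2α` is the total relative phase of the
qubit; the Hadamard sign `(-1)^v` contributes `-πv` to it. -/
lemma enorm_measurement_amplitude_sq (v : Fin 2) (t θ : ℝ) :
    ‖((1 / Real.sqrt 2 : ℝ) : ℂ) * (phaseQubit θ 0 + (-1) ^ (v : ℕ) *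
        (Complex.exp (t * ((1 : Fin 2) : ℕ) * Complex.I) * phaseQubit θ 1))‖ₑ ^ 2 =
      ENNReal.ofReal (Real.cos (Real.pi * θ + t / 2 - Real.pi / 2 * (v : ℕ)) ^ 2) := by
  have h2 : ((1 / Real.sqrt 2 : ℝ) : ℂ) * ((1 / Real.sqrt 2 : ℝ) : ℂ) = 1 / 2 := by
    rw [← Complex.ofReal_mul, div_mul_div_comm, Real.mul_self_sqrt (by norm_num)]
    norm_num
  set α : ℝ := Real.pi * θ + t / 2 - Real.pi / 2 * (v : ℕ) with hα
  have hv : ((-1 : ℂ)) ^ (v : ℕ) = Complex.exp (-(Real.pi * (v : ℕ) * Complex.I)) := by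
    rcases fin_two_cases v with h | h
    · simp [h]
    · simp [h, Complex.exp_neg, Complex.exp_pi_mul_I]
  have key : ((1 / Real.sqrt 2 : ℝ) : ℂ) * (phaseQubit θ 0 + (-1) ^ (v : ℕ) *
        (Complex.exp (t * ((1 : Fin 2) : ℕ) * Complex.I) * phaseQubit θ 1)) =
      Complex.exp ((α : ℝ) * Complex.I) * Complex.cos α := by
    have e1 : Complex.exp (-(Real.pi * (v : ℕ) * Complex.I)) *
        (Complex.exp (t * Complex.I) * Complex.exp (((2 * Real.pi * θ : ℝ) : ℂ) * Complex.I)) =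
        Complex.exp (α * Complex.I) * Complex.exp (α * Complex.I) := by
      rw [← Complex.exp_add, ← Complex.exp_add, ← Complex.exp_add, hα]
      congr 1
      push_cast
      ring
    have e2 : Complex.exp (α * Complex.I) * Complex.exp (-α * Complex.I) = 1 := by
      rw [← Complex.exp_add]; simp
    rw [hv, Complex.cos]
    simp only [phaseQubit, Fin.val_zero, Fin.val_one, Nat.cast_zero, Nat.cast_one, mul_one,
      mul_zero, Complex.ofReal_zero, zero_mul, Complex.exp_zero]
    linear_combination (1 + Complex.exp (α * Complex.I) * Complex.exp (α * Complex.I)) * h2 +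
      ((1 / Real.sqrt 2 : ℝ) : ℂ) * ((1 / Real.sqrt 2 : ℝ) : ℂ) * e1 - e2 / 2
  rw [key, enorm_mul, ← ofReal_norm, Complex.norm_exp_ofReal_mul_I, ENNReal.ofReal_one, one_mul,
    ← Complex.ofReal_cos, ← ofReal_norm, ← ENNReal.ofReal_pow (norm_nonneg _),
    Complex.norm_real, Real.norm_eq_abs, sq_abs]

lemma project_rotated_prodState {Q : Type} [Fintype Q] [DecidableEq Q] (φ : Q → Fin 2 → ℂ)
    (q : Q) (v : Fin 2) (t θ : ℝ) (hφ : φ q = phaseQubit θ) :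
    ∃ z : ℂ, ‖z‖ₑ ^ 2 =
        ENNReal.ofReal (Real.cos (Real.pi * θ + t / 2 - Real.pi / 2 * (v : ℕ)) ^ 2) ∧
      project q v ((Gate.hadamard q).apply ((Gate.phase q t).apply (prodState φ))) =
        z • prodState (Function.update φ q (Pi.single v 1)) := by
  refine ⟨_, enorm_measurement_amplitude_sq v t θ, ?_⟩
  rw [phase_prodState, hadamard_prodState, project_prodState]
  simp [hφ]

/-- Each measurement leaves a multiple of a product state, so the weights multiply along the branch
and build up the cosine product. `k` and `M` record the bits already found; `x` runs over the
numbers formed by those still to come. The continuation enters only through a bound `h` on its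
expectation. -/
lemma expect_iqftMeasure_le {d b c : ℕ} {α : Type} (f : Vec d → ℝ) (cont : ℕ → QProg d b c α)
    (g : α → ℝ≥0∞) (h : ℕ → ℝ≥0∞) (θ : ℝ) (l : List (Wire d b c)) (hl : l.Nodup) (k M : ℕ)
    (φ : Wire d b c → Fin 2 → ℂ) (hφ : IsNormalized φ)
    (hθ : ∀ j (hj : j < l.length), φ l[j] = phaseQubit (2 ^ (l.length - 1 - j) * θ))
    (hcont : ∀ M' φ', IsNormalized φ' → (∀ q ∉ l, φ' q = φ q) →
      (cont M').expect f (prodState φ') g ≤ h M') :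
    (iqftMeasure cont l k M).expect f (prodState φ) g ≤
      ∑ x ∈ Finset.range (2 ^ l.length),
        ENNReal.ofReal (cosProd l.length
          (Real.pi * (θ - ((M + 2 ^ k * x : ℕ) : ℝ) / 2 ^ (k + l.length)))) *
          h (M + 2 ^ k * x) := by
  induction l generalizing k M φ with
  | nil => simpa [iqftMeasure, cosProd] using hcont M φ hφ fun _ _ => rfl
  | cons q qs ih =>
    obtain ⟨hq, hqs⟩ := List.nodup_cons.mp hl
    have hqθ : φ q = phaseQubit (2 ^ qs.length * θ) := hθ 0 (by simp)
    rw [iqftMeasure, expect_gate, expect_gate, expect_meas]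
    have step : ∀ v : Fin 2, (iqftMeasure cont qs (k + 1) (M + (v : ℕ) * 2 ^ k)).expect f
        (project q v ((Gate.hadamard q).apply
          ((Gate.phase q (-(2 * Real.pi * M / 2 ^ (k + 1)))).apply (prodState φ)))) g ≤
        ∑ x ∈ Finset.range (2 ^ qs.length),
          ENNReal.ofReal (cosProd (qs.length + 1) (Real.pi *
            (θ - ((M + 2 ^ k * (2 * x + v) : ℕ) : ℝ) / 2 ^ (k + (qs.length + 1))))) *
          h (M + 2 ^ k * (2 * x + v)) := by
      intro v
      obtain ⟨z, hz, hz'⟩ := project_rotated_prodState φ q v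
        (-(2 * Real.pi * M / 2 ^ (k + 1))) _ hqθ
      rw [hz', expect_smul, hz]
      have hrec := ih hqs (k + 1) (M + (v : ℕ) * 2 ^ k) (Function.update φ q (Pi.single v 1))
        (hφ.update q (sum_enorm_single v)) (fun j hj => by
          have hne : qs[j] ≠ q := fun e => hq (e ▸ List.getElem_mem hj)
          rw [Function.update_of_ne hne]
          have := hθ (j + 1) (by simpa using hj)
          simp only [List.getElem_cons_succ, List.length_cons] at this
          rw [this, show qs.length + 1 - 1 - (j + 1) = qs.length - 1 - j by omega])
        (fun M' φ' h1 h2 => hcont M' φ' h1 fun p hp => by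
          simp only [List.mem_cons, not_or] at hp
          rw [h2 p hp.2, Function.update_of_ne hp.1])
      refine (mul_le_mul' le_rfl hrec).trans_eq ?_
      rw [Finset.mul_sum]
      refine Finset.sum_congr rfl fun x _ => ?_
      have e : M + (v : ℕ) * 2 ^ k + 2 ^ (k + 1) * x = M + 2 ^ k * (2 * x + v) := by ring
      rw [e, ← mul_assoc, ← ENNReal.ofReal_mul (sq_nonneg _)]
      congr 2
      rw [cosProd, cosProd, Finset.prod_range_succ, mul_comm, add_assoc k 1, add_comm 1]
      congr 1
      -- The bits not yet measured shift this qubit's angle by `xπ`, which the squared cosine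
      -- ignores. Hence a rotation by the bits known so far suffices.
      rw [← cos_sub_nat_mul_pi_sq _ x]
      congr 2
      push_cast
      rw [pow_add (2 : ℝ) k (qs.length + 1), pow_succ (2 : ℝ) qs.length, pow_succ (2 : ℝ) k]
      field_simp
      ring
    rw [Fin.sum_univ_two, List.length_cons, pow_succ' (2 : ℕ) qs.length, sum_range_two_mul, Finset.sum_add_distrib]
    exact add_le_add (step 0) (step 1)

lemma addrWire_injective {d b c : ℕ} (i : Fin d) :
    Function.Injective (addrWire i : Fin b → Wire d b c) := by
  intro j j' h
  simpa [addrWire] using h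

lemma getElem_reverse_map_addrWire {d b c : ℕ} (i : Fin d) (j : ℕ)
    (hj : j < ((List.finRange b).reverse.map (addrWire i : Fin b → Wire d b c)).length) :
    ∃ j' : Fin b, ((List.finRange b).reverse.map (addrWire i : Fin b → Wire d b c))[j] =
      addrWire i j' ∧ (j' : ℕ) = b - 1 - j := by
  simp only [List.length_map, List.length_reverse, List.length_finRange] at hj
  exact ⟨⟨b - 1 - j, by omega⟩, by simp, rfl⟩

/-- The semiclassical Fourier transform of one address register of a product state. -/
lemma expect_iqftMeasure_register_le {d b c : ℕ} {α : Type} (f : Vec d → ℝ)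
    (cont : ℕ → QProg d b c α)
    (g : α → ℝ≥0∞) (h : ℕ → ℝ≥0∞) (θ : ℝ) (i : Fin d)
    (φ : Wire d b c → Fin 2 → ℂ) (hφ : IsNormalized φ)
    (hθ : ∀ j, φ (addrWire i j) = phaseQubit (2 ^ (j : ℕ) * θ))
    (hcont : ∀ M' φ', IsNormalized φ' → (∀ q, (∀ j, addrWire i j ≠ q) → φ' q = φ q) →
      (cont M').expect f (prodState φ') g ≤ h M') :
    (iqftMeasure cont ((List.finRange b).reverse.map (addrWire i)) 0 0).expect f
        (prodState φ) g ≤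
      ∑ x ∈ Finset.range (2 ^ b),
        ENNReal.ofReal (cosProd b (Real.pi * (θ - (x : ℝ) / 2 ^ b))) * h x := by
  have := expect_iqftMeasure_le f cont g h θ
    ((List.finRange b).reverse.map (addrWire i : Fin b → Wire d b c))
    ((List.nodup_reverse.mpr (List.nodup_finRange b)).map (addrWire_injective i)) 0 0 φ hφ
    (fun j hj => by
      obtain ⟨j', h1, h2⟩ := getElem_reverse_map_addrWire (c := c) i j hj
      rw [h1, hθ, h2]
      simp)
    (fun M' φ' h1 h2 => hcont M' φ' h1 fun q hq => h2 q fun hmem => by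
      obtain ⟨j, _, hj⟩ := List.mem_map.mp hmem
      exact hq j hj)
  simpa using this

lemma sum_ofReal_cosProd (b : ℕ) (θ : ℝ) (p : ℝ≥0∞) :
    ∑ x ∈ Finset.range (2 ^ b),
      ENNReal.ofReal (cosProd b (Real.pi * (θ - (x : ℝ) / 2 ^ b))) * p = p := by
  rw [← Finset.sum_mul, ← ENNReal.ofReal_sum_of_nonneg fun _ _ => cosProd_nonneg _ _]
  have := sum_cosProd b (Real.pi * θ)
  simp only [mul_sub, mul_div_assoc] at this ⊢
  rw [this, ENNReal.ofReal_one, one_mul]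

/-- Once register `i₀` has been read, the remaining registers average out, as their outcome
probabilities sum to one. This closes the case of the induction below in which `i₀` is measured
first. -/
lemma expect_measureRegisters_not_mem_le {d b c : ℕ} (f : Vec d → ℝ) (h : ℕ → ℝ≥0∞) (i₀ : Fin d)
    (θ : Fin d → ℝ) (is : List (Fin d)) (his : is.Nodup) (hi₀ : i₀ ∉ is) (m : Fin d → ℕ)
    (φ : Wire d b c → Fin 2 → ℂ) (hφ : IsNormalized φ)
    (hθ : ∀ i ∈ is, ∀ j, φ (addrWire i j) = phaseQubit (2 ^ (j : ℕ) * θ i)) :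
    (measureRegisters is m).expect f (prodState φ) (fun a => h (a i₀)) ≤ h (m i₀) := by
  induction is generalizing m φ with
  | nil => rw [measureRegisters, expect_ret, normSq_prodState φ hφ, one_mul]
  | cons i is ih =>
    obtain ⟨hi, his⟩ := List.nodup_cons.mp his
    simp only [List.mem_cons, not_or] at hi₀
    rw [measureRegisters, ← sum_ofReal_cosProd b (θ i) (h (m i₀))]
    refine expect_iqftMeasure_register_le f _ _ (fun _ => h (m i₀)) (θ i) i φ hφ
      (hθ i List.mem_cons_self) fun M' φ' h1 h2 => ?_
    refine (ih his hi₀.2 (Function.update m i M') φ' h1 fun i' hi' j => ?_).trans_eq ?_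
    · rw [h2 _ fun j' e => hi ?_, hθ i' (List.mem_cons_of_mem _ hi')]
      simp only [addrWire, Sum.inl.injEq, Prod.mk.injEq] at e
      exact e.1 ▸ hi'
    · rw [Function.update_of_ne hi₀.1]

/-- The outcome of one of the registers in a measurement of all registers of a product state. -/
lemma expect_measureRegisters_le {d b c : ℕ} (f : Vec d → ℝ) (h : ℕ → ℝ≥0∞) (i₀ : Fin d)
    (θ : Fin d → ℝ) (is : List (Fin d)) (his : is.Nodup) (hi₀ : i₀ ∈ is) (m : Fin d → ℕ)
    (φ : Wire d b c → Fin 2 → ℂ) (hφ : IsNormalized φ)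
    (hθ : ∀ i ∈ is, ∀ j, φ (addrWire i j) = phaseQubit (2 ^ (j : ℕ) * θ i)) :
    (measureRegisters is m).expect f (prodState φ) (fun a => h (a i₀)) ≤
      ∑ x ∈ Finset.range (2 ^ b),
        ENNReal.ofReal (cosProd b (Real.pi * (θ i₀ - (x : ℝ) / 2 ^ b))) * h x := by
  induction is generalizing m φ with
  | nil => simp at hi₀
  | cons i is ih =>
    obtain ⟨hi, hnd⟩ := List.nodup_cons.mp his
    have rest : ∀ φ' : Wire d b c → Fin 2 → ℂ,
        (∀ q, (∀ j, addrWire i j ≠ q) → φ' q = φ q) →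
        ∀ i' ∈ is, ∀ j, φ' (addrWire i' j) = phaseQubit (2 ^ (j : ℕ) * θ i') := by
      intro φ' h2 i' hi' j
      rw [h2 _ fun j' e => hi ?_, hθ i' (List.mem_cons_of_mem _ hi')]
      simp only [addrWire, Sum.inl.injEq, Prod.mk.injEq] at e
      exact e.1 ▸ hi'
    rw [measureRegisters]
    by_cases hii : i₀ = i
    · subst hii
      refine expect_iqftMeasure_register_le f _ _ h (θ i₀) i₀ φ hφ
        (hθ i₀ List.mem_cons_self) fun M' φ' h1 h2 => ?_
      refine (expect_measureRegisters_not_mem_le f h i₀ θ is hnd hi (Function.update m i₀ M')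
        φ' h1 (rest φ' h2)).trans_eq ?_
      rw [Function.update_self]
    -- A register read before `i₀` is handled in the same way: the target bound does not depend on
    -- its outcome and is averaged over the kernel of total mass one.
    · rw [← sum_ofReal_cosProd b (θ i) (∑ x ∈ Finset.range (2 ^ b), _)]
      refine expect_iqftMeasure_register_le f _ _ (fun _ => _) (θ i) i φ hφ
        (hθ i List.mem_cons_self) fun M' φ' h1 h2 => ?_
      exact ih hnd ((List.mem_cons.mp hi₀).resolve_left hii) (Function.update m i M') φ' h1
        (rest φ' h2)

/-! ### The state prepared by the gradient estimator -/

lemma flatMap_map_eq_map_product {ι κ β : Type*} (l : List ι) (l' : List κ) (F : ι → κ → β) :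
    (l.flatMap fun i => l'.map (F i)) = (l ×ˢ l').map fun p => F p.1 p.2 := by
  simp only [SProd.sprod, List.product, List.map_flatMap, List.map_map]
  rfl

/-- The single-qubit states of the gradient estimator: the address registers hold Fourier states
with phases `θ`, the value register and the carry are zero. -/
noncomputable def jordanQubits (d b c : ℕ) (θ : Fin d → ℝ) : Wire d b c → Fin 2 → ℂ :=
  Sum.elim (fun p => phaseQubit (2 ^ (p.2 : ℕ) * θ p.1))
    (Sum.elim (fun _ => Pi.single 0 1)
      (Sum.elim (fun j => phaseQubit (-(2 ^ (j : ℕ) / 2 ^ c))) fun _ => Pi.single 0 1))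

lemma isNormalized_jordanQubits (d b c : ℕ) (θ : Fin d → ℝ) :
    IsNormalized (jordanQubits d b c θ) := by
  rintro (p | j | j | u)
  · exact sum_enorm_phaseQubit _
  · exact sum_enorm_single 0
  · exact sum_enorm_phaseQubit _
  · exact sum_enorm_single 0

lemma hadamard_zero_amplitude (v : Fin 2) :
    ((1 / Real.sqrt 2 : ℝ) : ℂ) * ((Pi.single 0 1 : Fin 2 → ℂ) 0 +
      (-1) ^ (v : ℕ) * (Pi.single 0 1 : Fin 2 → ℂ) 1) = phaseQubit 0 v := by
  simp [phaseQubit]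

lemma applyGates_prepare (d b c : ℕ) :
    applyGates ((List.finRange d).flatMap fun i =>
        (List.finRange b).map fun j => .hadamard (addrWire i j))
      (applyGates ((List.finRange c).flatMap fun j =>
        [.hadamard (phaseWire j), .phase (phaseWire j) (-(2 * Real.pi * 2 ^ (j : ℕ) / 2 ^ c))])
        (zeroState (Wire d b c))) = prodState (jordanQubits d b c 0) := by
  obtain ⟨φ, h1, h2, h3⟩ := applyGates_flatMap_prodState (phaseWire : Fin c → Wire d b c)
    (fun j j' h => by simpa [phaseWire] using h)
    (fun j => [.hadamard (phaseWire j), .phase (phaseWire j) (-(2 * Real.pi * 2 ^ (j : ℕ) / 2 ^ c))])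
    (fun _ => Pi.single 0 1) (fun j => phaseQubit (-(2 ^ (j : ℕ) / 2 ^ c)))
    (fun j φ hφ => by
      rw [applyGates_cons, applyGates_cons, applyGates_nil, hadamard_prodState, phase_prodState,
        hφ, Function.update_idem]
      congr 2
      funext v
      rw [Function.update_self, hadamard_zero_amplitude, phaseQubit, phaseQubit]
      rw [mul_left_comm, ← Complex.exp_add]
      congr 2
      push_cast
      ring)
    (List.finRange c) (List.nodup_finRange c) (fun _ => Pi.single 0 1) (fun _ _ => rfl)
  obtain ⟨φ', h1', h2', h3'⟩ := applyGates_flatMap_prodState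
    (fun p : Fin d × Fin b => (addrWire p.1 p.2 : Wire d b c))
    (fun p p' h => by simpa [addrWire, Prod.ext_iff] using h)
    (fun p => [.hadamard (addrWire p.1 p.2)])
    (fun _ => Pi.single 0 1) (fun _ => phaseQubit 0)
    (fun p φ hφ => by
      rw [applyGates_cons, applyGates_nil, hadamard_prodState, hφ]
      congr 2
      funext v
      exact hadamard_zero_amplitude v)
    (List.finRange d ×ˢ List.finRange b)
    ((List.nodup_finRange d).product (List.nodup_finRange b)) φ
    (fun p _ => h3 _ fun j _ => by simp [phaseWire, addrWire])
  rw [zeroState_eq_prodState, h1, flatMap_map_eq_map_product, ← List.flatMap_pure_eq_map]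
  refine h1'.trans ?_
  congr 1
  funext q
  rcases q with p | j | j | u
  · obtain ⟨i, j⟩ := p
    refine (h2' (i, j) (by simp)).trans ?_
    simp [jordanQubits]
  · rw [h3' _ fun p _ => by simp [addrWire], h3 _ fun p _ => by simp [phaseWire]]
    rfl
  · rw [h3' _ fun p _ => by simp [addrWire]]
    exact h2 j (by simp)
  · rw [h3' _ fun p _ => by simp [addrWire], h3 _ fun p _ => by simp [phaseWire]]
    rfl

lemma applyGates_map_phase {Q ι : Type} [DecidableEq Q] (w : ι → Q) (θ : ι → ℝ) (l : List ι)
    (ψ : State Q) (s : Q → Fin 2) :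
    applyGates (l.map fun p => .phase (w p) (θ p)) ψ s =
      Complex.exp (((l.map fun p => θ p * (s (w p) : ℕ)).sum : ℝ) * Complex.I) * ψ s := by
  induction l generalizing ψ with
  | nil => simp [applyGates]
  | cons p l ih =>
    rw [List.map_cons, applyGates_cons, ih, Gate.apply, ← mul_assoc, ← Complex.exp_add]
    congr 2
    simp only [List.map_cons, List.sum_cons]
    push_cast
    ring

lemma applyGates_sign (d b c : ℕ) (ψ : State (Wire d b c)) (s : Wire d b c → Fin 2) :
    applyGates ((List.finRange d).flatMap fun i =>
      (List.finRange b).map fun j => .phase (addrWire i j) (Real.pi * 2 ^ (j : ℕ))) ψ s =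
      Complex.exp ((Real.pi * ∑ i, (address s i : ℝ) : ℝ) * Complex.I) * ψ s := by
  rw [flatMap_map_eq_map_product, applyGates_map_phase (fun p : Fin d × Fin b => addrWire p.1 p.2)
    fun p => Real.pi * 2 ^ (p.2 : ℕ)]
  congr 4
  rw [← List.sum_toFinset _ ((List.nodup_finRange d).product (List.nodup_finRange b))]
  have : (List.finRange d ×ˢ List.finRange b).toFinset = Finset.univ := by
    ext ⟨i, j⟩; simp
  rw [this, Fintype.sum_prod_type, Finset.mul_sum]
  refine Finset.sum_congr rfl fun i _ => ?_
  rw [address]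
  push_cast
  rw [Finset.mul_sum]
  exact Finset.sum_congr rfl fun j _ => by ring

lemma phaseQubit_eq_exp_mul (θ : ℝ) (v : Fin 2) :
    phaseQubit θ v = Complex.exp ((2 * Real.pi * θ * (v : ℕ) : ℝ) * Complex.I) *
      ((1 / Real.sqrt 2 : ℝ) : ℂ) := mul_comm _ _

lemma prod_phaseQubit {ι : Type} [Fintype ι] (θ : ι → ℝ) (v : ι → Fin 2) :
    ∏ p, phaseQubit (θ p) (v p) =
      Complex.exp ((2 * Real.pi * ∑ p, θ p * (v p : ℕ) : ℝ) * Complex.I) *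
        ((1 / Real.sqrt 2 : ℝ) : ℂ) ^ Fintype.card ι := by
  simp only [phaseQubit_eq_exp_mul, Finset.prod_mul_distrib, Finset.prod_const, Finset.card_univ,
    ← Complex.exp_sum]
  congr 2
  rw [Finset.mul_sum]
  push_cast
  rw [Finset.sum_mul]
  exact Finset.sum_congr rfl fun p _ => by ring

lemma prodState_jordanQubits {d b c : ℕ} (θ : Fin d → ℝ) (s : Wire d b c → Fin 2) :
    prodState (jordanQubits d b c θ) s =
      (Complex.exp ((2 * Real.pi * ∑ i, θ i * (address s i : ℝ) : ℝ) * Complex.I) *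
        ((1 / Real.sqrt 2 : ℝ) : ℂ) ^ (d * b)) *
      ((∏ j, (Pi.single 0 1 : Fin 2 → ℂ) (s (valWire j))) *
        ((Complex.exp ((-(2 * Real.pi * (∑ j, (s (phaseWire j) : ℕ) * 2 ^ (j : ℕ) : ℕ) / 2 ^ c) : ℝ)
            * Complex.I) * ((1 / Real.sqrt 2 : ℝ) : ℂ) ^ c) *
          (Pi.single 0 1 : Fin 2 → ℂ) (s carryWire))) := by
  rw [prodState, Fintype.prod_sum_type, Fintype.prod_sum_type, Fintype.prod_sum_type]
  simp only [jordanQubits, Sum.elim_inl, Sum.elim_inr, Finset.univ_unique, Finset.prod_singleton]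
  rw [prod_phaseQubit, prod_phaseQubit, Fintype.card_prod, Fintype.card_fin, Fintype.card_fin,
    Fintype.card_fin, Fintype.sum_prod_type]
  have e1 : ∑ i, ∑ j : Fin b, 2 ^ (j : ℕ) * θ i * ((s (Sum.inl (i, j)) : ℕ) : ℝ) =
      ∑ i, θ i * (address s i : ℝ) := by
    refine Finset.sum_congr rfl fun i _ => ?_
    rw [address]
    push_cast
    rw [Finset.mul_sum]
    exact Finset.sum_congr rfl fun j _ => by rw [addrWire]; ring
  have e2 : 2 * Real.pi * ∑ j : Fin c,
      -((2 : ℝ) ^ (j : ℕ) / 2 ^ c) * ((s (Sum.inr (Sum.inr (Sum.inl j))) : ℕ) : ℝ) =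
      -(2 * Real.pi * (∑ j, (s (phaseWire j) : ℕ) * 2 ^ (j : ℕ) : ℕ) / 2 ^ c) := by
    push_cast
    rw [Finset.mul_sum, Finset.mul_sum, Finset.sum_div, ← Finset.sum_neg_distrib]
    exact Finset.sum_congr rfl fun j _ => by rw [phaseWire]; ring
  rw [e1, e2]
  rfl

/-- The Fourier state with phases `θ` has amplitudes of the same modulus as the uniform one.
Comparing it with the actual state therefore reduces to comparing real phases. -/
lemma prodState_jordanQubits_eq_exp_mul {d b c : ℕ} (θ : Fin d → ℝ) (s : Wire d b c → Fin 2) :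
    prodState (jordanQubits d b c θ) s =
      Complex.exp ((2 * Real.pi * ∑ i, θ i * (address s i : ℝ) : ℝ) * Complex.I) *
        prodState (jordanQubits d b c 0) s := by
  rw [prodState_jordanQubits, prodState_jordanQubits]
  simp only [Pi.zero_apply, zero_mul, Finset.sum_const_zero, mul_zero, Complex.ofReal_zero,
    Complex.exp_zero, one_mul]
  ring

/-- Phase kickback: a translation of the phase register by `F` multiplies by a phase. -/
lemma prodState_jordanQubits_translate {d b c : ℕ} (s t : Wire d b c → Fin 2) (F : ℤ)
    (ha : ∀ i j, t (addrWire i j) = s (addrWire i j))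
    (hv : ∀ j, t (valWire j) = s (valWire j)) (hc : t carryWire = s carryWire)
    (hp : (∀ j, s (valWire j) = 0) → s carryWire = 0 →
      ((∑ j, (t (phaseWire j) : ℕ) * 2 ^ (j : ℕ) : ℕ) : ℤ) + F ≡
        ((∑ j, (s (phaseWire j) : ℕ) * 2 ^ (j : ℕ) : ℕ) : ℤ) [ZMOD 2 ^ c]) :
    prodState (jordanQubits d b c 0) t =
      Complex.exp ((2 * Real.pi * F / 2 ^ c : ℝ) * Complex.I) *
        prodState (jordanQubits d b c 0) s := by
  have hadd : ∀ i, address t i = address s i := fun i => by simp only [address, ha]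
  rw [prodState_jordanQubits, prodState_jordanQubits]
  simp only [hadd, hv, hc]
  -- Away from a zero value register and a zero carry both amplitudes vanish, so the congruence is
  -- only needed in the first case.
  by_cases h : (∀ j, s (valWire j) = 0) ∧ s carryWire = 0
  · have hmod := hp h.1 h.2
    generalize (∑ j, (t (phaseWire j) : ℕ) * 2 ^ (j : ℕ) : ℕ) = A at *
    generalize (∑ j, (s (phaseWire j) : ℕ) * 2 ^ (j : ℕ) : ℕ) = B at *
    have key : Complex.exp ((-(2 * Real.pi * A / 2 ^ c) : ℝ) * Complex.I) =
        Complex.exp ((2 * Real.pi * F / 2 ^ c : ℝ) * Complex.I) *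
          Complex.exp ((-(2 * Real.pi * B / 2 ^ c) : ℝ) * Complex.I) := by
      rw [← Complex.exp_add, Complex.exp_eq_exp_iff_exists_int]
      obtain ⟨n, hn⟩ := hmod.dvd
      refine ⟨n, ?_⟩
      have hn' : (B : ℂ) - (A + F) = 2 ^ c * n := by exact_mod_cast hn
      have h2 : (2 : ℂ) ^ c ≠ 0 := pow_ne_zero _ two_ne_zero
      push_cast
      field_simp
      linear_combination hn'
    rw [key]
    ring
  · rw [not_and_or] at h
    rcases h with h | h
    · push Not at h
      obtain ⟨j, hj⟩ := h
      rw [Finset.prod_eq_zero (Finset.mem_univ j) (by simp [hj])]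
      ring
    · rw [show (Pi.single 0 1 : Fin 2 → ℂ) (s carryWire) = 0 by simp [h]]
      ring

/-! ### The outcome distribution of the gradient estimator -/

lemma oracleValue_congr {d b c : ℕ} (f : Vec d → ℝ) (x : Vec d) (h η : ℝ)
    {s t : Wire d b c → Fin 2} (hst : ∀ i j, t (addrWire i j) = s (addrWire i j)) :
    oracleValue f x h η t = oracleValue f x h η s := by
  have : ∀ i, address t i = address s i := fun i => by simp only [address, hst]
  simp only [oracleValue, gridPoint, this]

lemma wordEquiv_valWire_shiftValue {d b c : ℕ} (k : ZMod (2 ^ c)) (s : Wire d b c → Fin 2) :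
    wordEquiv c (fun j => shiftValue k s (valWire j)) =
      wordEquiv c (fun j => s (valWire j)) + k :=
  (wordEquiv c).apply_symm_apply _

/-- Evaluation of the function, addition to the phase register and uncomputation amount to a
phase on the prepared state. -/
lemma evaluate_add_uncompute {d b c : ℕ} (f : Vec d → ℝ) (x : Vec d) (h η : ℝ)
    (s : Wire d b c → Fin 2) :
    oracleApply f true x h η (oracleApply f false x 0 η
      (applyGates (adder ((List.finRange c).map fun j => (valWire j, phaseWire j)) carryWire)
        (oracleApply f true x 0 η (oracleApply f false x h η
          (prodState (jordanQubits d b c 0)))))) s =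
      Complex.exp ((2 * Real.pi * (oracleValue f x h η s - oracleValue f x 0 η s : ℤ) / 2 ^ c : ℝ)
        * Complex.I) * prodState (jordanQubits d b c 0) s := by
  have hfst : ((List.finRange c).map fun j =>
      ((valWire j, phaseWire j) : Wire d b c × Wire d b c)).map Prod.fst =
      (List.finRange c).map valWire := by rw [List.map_map]; rfl
  have hsnd : ((List.finRange c).map fun j =>
      ((valWire j, phaseWire j) : Wire d b c × Wire d b c)).map Prod.snd =
      (List.finRange c).map phaseWire := by rw [List.map_map]; rfl
  obtain ⟨σ, hσ, hσ'⟩ := applyGates_adder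
    ((List.finRange c).map fun j => ((valWire j, phaseWire j) : Wire d b c × Wire d b c))
    carryWire (by
      rw [hfst, hsnd, List.nodup_cons, List.nodup_append]
      refine ⟨by simp [carryWire, valWire, phaseWire], ?_, ?_, ?_⟩
      · exact (List.nodup_finRange c).map fun j j' h => by simpa [valWire] using h
      · exact (List.nodup_finRange c).map fun j j' h => by simpa [phaseWire] using h
      · simp [valWire, phaseWire])
  rw [hfst, hsnd] at hσ'
  simp only [List.length_map, List.length_finRange] at hσ'
  rw [hσ]
  set k₁ := oracleValue f x h η s with hk₁
  set k₀ := oracleValue f x 0 η s with hk₀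
  -- `s₁, …, s₅` are the successive preimages of `s`, starting from the last operation. Address
  -- wires never change, so every oracle call along the way uses the same `k₁` or `k₀`, and the
  -- adder sees `k₁ - k₀` when the value register of `s` is zero.
  set s₁ := shiftValue (k₁ : ZMod (2 ^ c)) s with hs₁
  set s₂ := shiftValue (-(k₀ : ZMod (2 ^ c))) s₁ with hs₂
  set s₃ := σ s₂ with hs₃
  obtain ⟨h1, h2⟩ := hσ' s₂
  rw [← hs₃] at h1 h2
  have a3 : ∀ i j, s₃ (addrWire i j) = s (addrWire i j) := fun i j =>
    h1 _ (by simp [addrWire, phaseWire])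
  have v3 : ∀ j, s₃ (valWire j) = s₂ (valWire j) := fun j => h1 _ (by simp [valWire, phaseWire])
  have c3 : s₃ carryWire = s carryWire := h1 _ (by simp [carryWire, phaseWire])
  have o3 : ∀ h', oracleValue f x h' η s₃ = oracleValue f x h' η s :=
    fun h' => oracleValue_congr f x h' η a3
  set s₄ := shiftValue (k₀ : ZMod (2 ^ c)) s₃ with hs₄
  set s₅ := shiftValue (-(k₁ : ZMod (2 ^ c))) s₄ with hs₅
  have lhs : oracleApply f true x h η (oracleApply f false x 0 η
      ((fun s' => oracleApply f true x 0 η (oracleApply f false x h η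
          (prodState (jordanQubits d b c 0))) (σ s')))) s = prodState (jordanQubits d b c 0) s₅ := by
    simp only [oracleApply, if_true, Bool.false_eq_true, if_false, oracleValue_shiftValue]
    rw [← hk₁, ← hk₀, ← hs₁, ← hs₂, ← hs₃]
    rw [o3, o3, ← hk₁, ← hk₀, ← hs₄, ← hs₅]
  rw [lhs]
  have word2 : wordEquiv c (fun j => s₂ (valWire j)) =
      wordEquiv c (fun j => s (valWire j)) + ((k₁ - k₀ : ℤ) : ZMod (2 ^ c)) := by
    rw [hs₂, wordEquiv_valWire_shiftValue, hs₁, wordEquiv_valWire_shiftValue]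
    push_cast
    ring
  refine prodState_jordanQubits_translate s s₅ (k₁ - k₀) a3 ?_ c3 fun hv hc => ?_
  · have : (fun j => s₅ (valWire j)) = fun j => s (valWire j) := by
      apply (wordEquiv c).injective
      rw [hs₅, wordEquiv_valWire_shiftValue, hs₄, wordEquiv_valWire_shiftValue]
      simp only [v3]
      rw [word2]
      push_cast
      ring
    exact fun j => congrFun this j
  · have p5 : ∀ j, s₅ (phaseWire j) = s₃ (phaseWire j) := fun j => rfl
    have p2 : ∀ j, s₂ (phaseWire j) = s (phaseWire j) := fun j => rfl
    have c2 : s₂ carryWire = s carryWire := rfl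
    rw [listNum_map_finRange, listNum_map_finRange, listNum_map_finRange, c2, hc] at h2
    simp only [p2] at h2
    simp only [p5]
    have hz : wordEquiv c (fun j => s (valWire j)) = 0 := by
      rw [wordEquiv_eq_cast]; simp [hv]
    rw [hz, zero_add, wordEquiv_eq_cast] at word2
    have h2' := (ZMod.natCast_eq_natCast_iff _ _ _).mpr h2
    rw [Nat.cast_add, Nat.cast_add, word2] at h2'
    have := (ZMod.intCast_eq_intCast_iff
      (((∑ j, (s₃ (phaseWire j) : ℕ) * 2 ^ (j : ℕ) : ℕ) : ℤ) + (k₁ - k₀))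
      ((∑ j, (s (phaseWire j) : ℕ) * 2 ^ (j : ℕ) : ℕ) : ℤ) (2 ^ c)).mp (by
        rw [Int.cast_add, Int.cast_natCast, Int.cast_natCast]
        simpa using h2')
    exact_mod_cast this

lemma norm_exp_sub_exp_le (A B : ℝ) :
    ‖Complex.exp (A * Complex.I) - Complex.exp (B * Complex.I)‖ ≤ |A - B| := by
  have h : Complex.exp (A * Complex.I) - Complex.exp (B * Complex.I) =
      Complex.exp (B * Complex.I) * (Complex.exp (Complex.I * ((A - B : ℝ) : ℂ)) - 1) := by
    rw [mul_sub, ← Complex.exp_add, mul_one]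
    congr 2
    push_cast
    ring
  rw [h, norm_mul, Complex.norm_exp_ofReal_mul_I, one_mul]
  exact Real.norm_exp_I_mul_ofReal_sub_one_le

lemma normSq_le_of_norm_le {Q : Type} [Fintype Q] [DecidableEq Q] (ψ φ : State Q) (e : ℝ)
    (he : 0 ≤ e) (h : ∀ s, ‖ψ s‖ ≤ e * ‖φ s‖) : normSq ψ ≤ ENNReal.ofReal (e ^ 2) * normSq φ := by
  rw [normSq, normSq, Finset.mul_sum]
  refine Finset.sum_le_sum fun s _ => ?_
  rw [ENNReal.ofReal_pow he, ← mul_pow]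
  gcongr
  rw [← ofReal_norm, ← ofReal_norm, ← ENNReal.ofReal_mul he]
  exact ENNReal.ofReal_le_ofReal (h s)

/-- The outcome of one register of the gradient estimator is, up to the error `e` of the phases,
distributed as in the estimation of the phase `1/2 + v_i / (2G)`. -/
lemma two_mul_expect_jordanCircuit_le {d b c : ℕ} (f : Vec d → ℝ) (x : Vec d) (r G : ℝ)
    (v : Fin d → ℝ) (h : ℕ → ℝ≥0∞) (hh : ∀ m, h m ≤ 1) (i₀ : Fin d) (e : ℝ) (he : 0 ≤ e)
    (herr : ∀ s : Wire d b c → Fin 2,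
      |2 * Real.pi * ((oracleValue f x (r / 2 ^ b) (2 * G * r / (2 ^ b * 2 ^ c)) s -
          oracleValue f x 0 (2 * G * r / (2 ^ b * 2 ^ c)) s : ℤ) : ℝ) / 2 ^ c -
        2 * Real.pi * ∑ i, v i / (2 * G) * ((address s i : ℝ) - 2 ^ b / 2)| ≤ e) :
    2 * (jordanCircuit d b c x r G).expect f (zeroState _) (fun a => h (a i₀)) ≤
      3 * ∑ m ∈ Finset.range (2 ^ b), ENNReal.ofReal
        (cosProd b (Real.pi * (1 / 2 + v i₀ / (2 * G) - (m : ℝ) / 2 ^ b))) * h m +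
      6 * ENNReal.ofReal (e ^ 2) := by
  set η : ℝ := 2 * G * r / (2 ^ b * 2 ^ c) with hη
  set θ : Fin d → ℝ := fun i => 1 / 2 + v i / (2 * G) with hθ
  rw [jordanCircuit]
  simp only [← hη]
  rw [expect_runGates, expect_runGates, applyGates_prepare, expect_query, expect_query,
    expect_runGates, expect_query, expect_query, expect_runGates]
  set ψ : State (Wire d b c) := oracleApply f true x (r / 2 ^ b) η (oracleApply f false x 0 η
      (applyGates (adder ((List.finRange c).map fun j => (valWire j, phaseWire j)) carryWire)
        (oracleApply f true x 0 η (oracleApply f false x (r / 2 ^ b) η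
          (prodState (jordanQubits d b c 0)))))) with hψ
  set Ψ := applyGates ((List.finRange d).flatMap fun i =>
    (List.finRange b).map fun j => .phase (addrWire i j) (Real.pi * 2 ^ (j : ℕ))) ψ with hΨ
  -- Centring the addresses at `2^b/2` contributes only this global phase, which no outcome weight
  -- detects. The sign `(-1)^{u_i}` supplies the `1/2` in `θ`.
  set A : ℝ := -(2 * Real.pi * ∑ i, v i / (2 * G) * (2 ^ b / 2)) with hA
  set Φ : State (Wire d b c) :=
    Complex.exp (A * Complex.I) • prodState (jordanQubits d b c θ) with hΦ
  have hdiff : normSq (Ψ - Φ) ≤ ENNReal.ofReal (e ^ 2) := by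
    rw [← mul_one (ENNReal.ofReal (e ^ 2)),
      ← normSq_prodState _ (isNormalized_jordanQubits d b c 0)]
    refine normSq_le_of_norm_le _ _ e he fun s => ?_
    have e1 : Ψ s = Complex.exp ((Real.pi * ∑ i, (address s i : ℝ) +
        2 * Real.pi * (oracleValue f x (r / 2 ^ b) η s - oracleValue f x 0 η s : ℤ) / 2 ^ c : ℝ)
        * Complex.I) * prodState (jordanQubits d b c 0) s := by
      rw [hΨ, applyGates_sign, hψ, evaluate_add_uncompute, ← mul_assoc, ← Complex.exp_add,
        ← add_mul, ← Complex.ofReal_add]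
    have e2 : Φ s = Complex.exp ((A + 2 * Real.pi * ∑ i, θ i * (address s i : ℝ) : ℝ) *
        Complex.I) * prodState (jordanQubits d b c 0) s := by
      rw [hΦ, Pi.smul_apply, smul_eq_mul, prodState_jordanQubits_eq_exp_mul, ← mul_assoc,
        ← Complex.exp_add, ← add_mul, ← Complex.ofReal_add]
    rw [Pi.sub_apply, e1, e2, ← sub_mul, norm_mul]
    refine mul_le_mul_of_nonneg_right ((norm_exp_sub_exp_le _ _).trans ?_) (norm_nonneg _)
    refine le_of_eq_of_le ?_ (herr s)
    congr 1
    have e3 : ∑ i, θ i * (address s i : ℝ) = 1 / 2 * ∑ i, (address s i : ℝ) +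
        ∑ i, v i / (2 * G) * (address s i : ℝ) := by
      rw [Finset.mul_sum, ← Finset.sum_add_distrib]
      exact Finset.sum_congr rfl fun i _ => by rw [hθ]; ring
    simp only [mul_sub, Finset.sum_sub_distrib]
    rw [e3, hA]
    ring
  have hideal : (measureRegisters (List.finRange d) 0).expect f Φ (fun a => h (a i₀)) ≤
      ∑ m ∈ Finset.range (2 ^ b), ENNReal.ofReal
        (cosProd b (Real.pi * (θ i₀ - (m : ℝ) / 2 ^ b))) * h m := by
    rw [hΦ, expect_smul, ← ofReal_norm, Complex.norm_exp_ofReal_mul_I, ENNReal.ofReal_one,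
      one_pow, one_mul]
    exact expect_measureRegisters_le f h i₀ θ _ (List.nodup_finRange d) (List.mem_finRange i₀) 0 _
      (isNormalized_jordanQubits d b c θ) fun i _ j => rfl
  have hΨΦ : Ψ = Φ + (Ψ - Φ) := by abel
  rw [hΨΦ]
  refine (two_mul_expect_add_le f _ _ _ _ fun a => hh _).trans ?_
  gcongr

/-! ### The `ℓ₁`-ball and smooth functions -/

lemma convex_l1Ball (d : ℕ) : Convex ℝ (l1Ball d) := by
  intro x hx y hy a b ha hb hab
  have hx' : ∑ i, |x i| ≤ 1 := hx
  have hy' : ∑ i, |y i| ≤ 1 := hy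
  calc ∑ i, |(a • x + b • y) i| ≤ ∑ i, (a * |x i| + b * |y i|) := by
        refine Finset.sum_le_sum fun i _ => ?_
        simp only [PiLp.add_apply, PiLp.smul_apply, smul_eq_mul]
        refine (abs_add_le _ _).trans_eq ?_
        rw [abs_mul, abs_mul, abs_of_nonneg ha, abs_of_nonneg hb]
    _ = a * ∑ i, |x i| + b * ∑ i, |y i| := by
        rw [Finset.sum_add_distrib, Finset.mul_sum, Finset.mul_sum]
    _ ≤ 1 := by nlinarith

lemma single_mem_l1Ball {d : ℕ} (i : Fin d) : EuclideanSpace.single i (1 : ℝ) ∈ l1Ball d := by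
  have : ∀ j, |(EuclideanSpace.single i (1 : ℝ) : Vec d) j| = if j = i then 1 else 0 := by
    intro j
    by_cases h : j = i <;> simp [h]
  simp only [l1Ball, Set.mem_ofPred_eq, this]
  simp

lemma neg_mem_l1Ball {d : ℕ} {x : Vec d} (hx : x ∈ l1Ball d) : -x ∈ l1Ball d := by
  simpa [l1Ball] using hx

lemma l1Ball_mem_nhds {d : ℕ} {x : Vec d} (hx : ∑ i, |x i| < 1) : l1Ball d ∈ nhds x := by
  have hc : Continuous fun y : Vec d => ∑ i, |y i| := by fun_prop
  filter_upwards [hc.continuousAt.eventually (gt_mem_nhds hx)] with y hy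
  exact le_of_lt hy

section
variable {d : ℕ} {f : Vec d → ℝ} {L G : ℝ}

lemma inner_gradient_eq_fderiv (x v : Vec d) : inner ℝ v (gradient f x) = fderiv ℝ f x v := by
  rw [← toDual_gradient, InnerProductSpace.toDual_apply_apply, real_inner_comm]

lemma IsSmooth.abs_taylor_le (hf : IsSmooth f L) (hL : 0 ≤ L) (x y : Vec d) :
    |f y - f x - inner ℝ (y - x) (gradient f x)| ≤ L * ‖y - x‖ ^ 2 := by
  have := (convex_closedBall x ‖y - x‖).norm_image_sub_le_of_norm_hasFDerivWithin_le'
    (f := f) (f' := fderiv ℝ f) (φ := fderiv ℝ f x) (C := L * ‖y - x‖) (x := x) (y := y)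
    (fun z _ => (hf.1 z).hasFDerivAt.hasFDerivWithinAt)
    (fun z hz => by
      rw [← toDual_gradient, ← toDual_gradient, ← map_sub, LinearIsometryEquiv.norm_map]
      refine (hf.2 z x).trans ?_
      rw [mem_closedBall_iff_norm] at hz
      gcongr)
    (by simp) (by simp [dist_eq_norm])
  rw [inner_gradient_eq_fderiv, ← Real.norm_eq_abs, pow_two, ← mul_assoc]
  exact this

lemma IsSmooth.continuous_gradient (hf : IsSmooth f L) : Continuous (gradient f) := by
  have : LipschitzWith L.toNNReal (gradient f) := by
    refine LipschitzWith.of_dist_le_mul fun x y => ?_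
    rw [dist_eq_norm, dist_eq_norm]
    refine (hf.2 x y).trans ?_
    gcongr
    exact Real.le_coe_toNNReal L
  exact this.continuous

/-- The gradient of a `G`-Lipschitz smooth function is bounded by `G`, up to the boundary of the
ball. -/
lemma norm_gradient_le (hf : IsSmooth f L) (hG : 0 ≤ G) (hl : IsLipschitzOn f G (l1Ball d))
    {x : Vec d} (hx : x ∈ l1Ball d) : ‖gradient f x‖ ≤ G := by
  have hx' : ∑ i, |x i| ≤ 1 := hx
  have interior : ∀ z : Vec d, ∑ i, |z i| < 1 → ‖gradient f z‖ ≤ G := by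
    intro z hz
    have h := (hf.1 z).hasFDerivAt.le_of_lip' hG (by
      filter_upwards [l1Ball_mem_nhds hz] with y hy
      rw [Real.norm_eq_abs, norm_sub_rev]
      exact hl y hy z hz.le)
    rwa [← toDual_gradient, LinearIsometryEquiv.norm_map] at h
  -- The Lipschitz condition bounds the full derivative only in the interior of the ball. A boundary
  -- point is approached along the ray `t • x`, `t < 1`, and continuity of the gradient carries the
  -- bound over.
  have hc : Continuous fun t : ℝ => ‖gradient f (t • x)‖ :=
    (hf.continuous_gradient.comp (continuous_id.smul continuous_const)).norm
  have ht : Filter.Tendsto (fun t : ℝ => ‖gradient f (t • x)‖) (nhdsWithin 1 (Set.Iio 1))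
      (nhds ‖gradient f x‖) := by
    have := hc.tendsto 1
    rw [one_smul] at this
    exact this.mono_left nhdsWithin_le_nhds
  refine le_of_tendsto ht ?_
  filter_upwards [Ioo_mem_nhdsLT (show (0 : ℝ) < 1 by norm_num)] with t ht'
  refine interior _ ?_
  calc ∑ i, |(t • x) i| = t * ∑ i, |x i| := by
        rw [Finset.mul_sum]
        refine Finset.sum_congr rfl fun i _ => ?_
        rw [PiLp.smul_apply, smul_eq_mul, abs_mul, abs_of_pos ht'.1]
    _ < 1 := by nlinarith [ht'.1, ht'.2]

lemma abs_gradient_apply_le (hf : IsSmooth f L) (hG : 0 ≤ G) (hl : IsLipschitzOn f G (l1Ball d))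
    {x : Vec d} (hx : x ∈ l1Ball d) (i : Fin d) : |gradient f x i| ≤ G :=
  (PiLp.norm_apply_le (gradient f x) i).trans (norm_gradient_le hf hG hl hx)

/-- The first-order condition for convexity on the ball alone. A deficit `e > 0` would enter
linearly in the step length along the segment, whereas the Taylor error is quadratic. -/
lemma IsSmooth.inner_gradient_le (hf : IsSmooth f L) (hL : 0 ≤ L)
    (hc : ConvexOn ℝ (l1Ball d) f) {x y : Vec d} (hx : x ∈ l1Ball d) (hy : y ∈ l1Ball d) :
    inner ℝ (y - x) (gradient f x) ≤ f y - f x := by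
  by_contra! hlt
  set e : ℝ := inner ℝ (y - x) (gradient f x) - (f y - f x) with he
  have he0 : 0 < e := by linarith
  set K : ℝ := L * ‖y - x‖ ^ 2 with hK
  have hK0 : 0 ≤ K := by positivity
  -- Chosen so that `0 < t ≤ 1` and `tK < e`; the `+ 1` spares a case distinction on `K = 0`.
  set t : ℝ := e / (e + K + 1) with ht
  have ht0 : 0 < t := by positivity
  have ht1 : t ≤ 1 := by rw [ht, div_le_one (by positivity)]; linarith
  have htK : t * K < e := by
    rw [ht, div_mul_eq_mul_div, div_lt_iff₀ (by positivity)]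
    nlinarith
  have h1 := hc.2 hx hy (show 0 ≤ 1 - t by linarith) ht0.le (by ring)
  have h2 := hf.abs_taylor_le hL x ((1 - t) • x + t • y)
  have e1 : (1 - t) • x + t • y - x = t • (y - x) := by module
  rw [e1, real_inner_smul_left, norm_smul, Real.norm_eq_abs, abs_of_pos ht0, mul_pow] at h2
  have h3 := (abs_le.mp h2).1
  simp only [smul_eq_mul] at h1
  have : t * e ≤ t * (t * K) := by rw [he]; nlinarith
  have := le_of_mul_le_mul_left this ht0
  linarith

/-! ### The curvature -/

/-- The curvature bound; the curvature is a genuine supremum if it is positive. -/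
lemma le_add_curvature (h0 : 0 < curvature f (l1Ball d)) {x s : Vec d} (hx : x ∈ l1Ball d)
    (hs : s ∈ l1Ball d) {β : ℝ} (hβ : β ∈ Set.Ioc (0 : ℝ) 1) :
    f (x + β • (s - x)) ≤ f x + β * inner ℝ (s - x) (gradient f x) +
      β ^ 2 / 2 * curvature f (l1Ball d) := by
  have hbdd : BddAbove {c : ℝ | ∃ x ∈ l1Ball d, ∃ s ∈ l1Ball d, ∃ β ∈ Set.Ioc (0 : ℝ) 1,
    c = 2 / β ^ 2 *
      (f (x + β • (s - x)) - f x - inner ℝ (β • (s - x)) (gradient f x))} := by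
    -- The real supremum of an unbounded set is `0` by convention, so positivity forces boundedness.
    by_contra h
    rw [curvature, Real.sSup_of_not_bddAbove h] at h0
    exact lt_irrefl _ h0
  have := le_csSup hbdd ⟨x, hx, s, hs, β, hβ, rfl⟩
  rw [← curvature, real_inner_smul_left] at this
  have hβ2 : 0 < β ^ 2 := by have := hβ.1; positivity
  rw [div_mul_eq_mul_div, div_le_iff₀ hβ2] at this
  linarith

/-- Without such a pair every element of the defining set would be nonpositive, and so would its
supremum. The pair excludes the degenerate cases `d = 0`, `L = 0` and `G = 0`. -/
lemma exists_pos_of_curvature_pos (h0 : 0 < curvature f (l1Ball d)) :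
    ∃ x ∈ l1Ball d, ∃ y ∈ l1Ball d, inner ℝ (y - x) (gradient f x) < f y - f x := by
  by_contra! h
  refine absurd h0 (not_lt.mpr (Real.sSup_nonpos ?_))
  rintro c ⟨x, hx, s, hs, β, hβ, rfl⟩
  have hmem : x + β • (s - x) ∈ l1Ball d := by
    have := convex_l1Ball d hx hs (show 0 ≤ 1 - β by linarith [hβ.2]) hβ.1.le (by ring)
    rwa [show (1 - β) • x + β • s = x + β • (s - x) by module] at this
  have := h x hx _ hmem
  rw [add_sub_cancel_left] at this
  exact mul_nonpos_of_nonneg_of_nonpos (by positivity) (by linarith)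

lemma dim_pos_of_curvature_pos (h0 : 0 < curvature f (l1Ball d)) : 0 < d := by
  by_contra h
  obtain rfl : d = 0 := by omega
  obtain ⟨x, -, y, -, h⟩ := exists_pos_of_curvature_pos h0
  rw [Subsingleton.elim y x] at h
  simp at h

lemma smoothness_pos_of_curvature_pos (hf : IsSmooth f L) (h0 : 0 < curvature f (l1Ball d)) :
    0 < L := by
  obtain ⟨x, -, y, -, h⟩ := exists_pos_of_curvature_pos h0
  have hxy : x ≠ y := by rintro rfl; simp at h
  have hn : 0 < ‖x - y‖ := norm_pos_iff.mpr (sub_ne_zero.mpr hxy)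
  have hL : 0 ≤ L := by
    have := (norm_nonneg _).trans (hf.2 x y)
    exact nonneg_of_mul_nonneg_left this hn
  refine hL.lt_of_ne fun hL0 => ?_
  have := (abs_le.mp (hf.abs_taylor_le hL x y)).2
  rw [← hL0, zero_mul] at this
  linarith

/-- With `G = 0` the function is constant on the ball and its gradient vanishes there, so no pair of
points has a strictly positive Taylor remainder. -/
lemma lipschitz_pos_of_curvature_pos (hf : IsSmooth f L) (hl : IsLipschitzOn f G (l1Ball d))
    (h0 : 0 < curvature f (l1Ball d)) : 0 < G := by
  obtain ⟨x, hx, y, hy, h⟩ := exists_pos_of_curvature_pos h0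
  have hxy : x ≠ y := by rintro rfl; simp at h
  have hn : 0 < ‖y - x‖ := norm_pos_iff.mpr (sub_ne_zero.mpr hxy.symm)
  have hG : 0 ≤ G := nonneg_of_mul_nonneg_left ((abs_nonneg _).trans (hl x hx y hy)) hn
  refine hG.lt_of_ne fun hG0 => ?_
  have h1 := norm_gradient_le hf hG hl hx
  have h2 := hl x hx y hy
  rw [← hG0] at h1 h2
  rw [norm_le_zero_iff.mp h1, inner_zero_right] at h
  rw [zero_mul] at h2
  linarith [(abs_le.mp h2).1]

/-! ### The linear subproblem -/

lemma exists_direction_eq (hd : 0 < d) (g : Fin d → ℝ) : ∃ i, (∀ j, |g j| ≤ |g i|) ∧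
    direction g = if 0 ≤ g i then -EuclideanSpace.single i 1 else EuclideanSpace.single i 1 := by
  cases h : (List.finRange d).argmax (fun i => |g i|) with
  | none =>
    rw [List.argmax_eq_none] at h
    have := congrArg List.length h
    simp at this
    omega
  | some i =>
    refine ⟨i, fun j => List.le_of_mem_argmax (f := fun i => |g i|) (List.mem_finRange j) h, ?_⟩
    simp only [direction, h]

lemma direction_mem (hd : 0 < d) (g : Fin d → ℝ) : direction g ∈ l1Ball d := by
  obtain ⟨i, -, h⟩ := exists_direction_eq hd g
  rw [h]
  split
  · exact neg_mem_l1Ball (single_mem_l1Ball i)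
  · exact single_mem_l1Ball i

/-- Hölder duality between the `ℓ₁` and `ℓ_∞` norms. -/
lemma abs_inner_le {y v : Vec d} (hy : y ∈ l1Ball d) {B : ℝ} (hB : 0 ≤ B)
    (hv : ∀ j, |v j| ≤ B) : |inner ℝ y v| ≤ B := by
  have hy' : ∑ i, |y i| ≤ 1 := hy
  calc |inner ℝ y v| = |∑ j, v j * y j| := by
        rw [PiLp.inner_apply]
        rfl
    _ ≤ ∑ j, |v j * y j| := Finset.abs_sum_le_sum_abs _ _
    _ ≤ ∑ j, B * |y j| := by
        refine Finset.sum_le_sum fun j _ => ?_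
        rw [abs_mul]
        exact mul_le_mul_of_nonneg_right (hv j) (abs_nonneg _)
    _ = B * ∑ j, |y j| := by rw [Finset.mul_sum]
    _ ≤ B := by nlinarith

/-- The direction computed from a gradient estimate with componentwise error `κ` solves the linear
subproblem up to `2κ`. -/
lemma inner_direction_le (hd : 0 < d) (g : Fin d → ℝ) (v : Vec d) {κ : ℝ}
    (hg : ∀ j, |g j - v j| ≤ κ) {y : Vec d} (hy : y ∈ l1Ball d) :
    inner ℝ (direction g) v ≤ inner ℝ y v + 2 * κ := by
  obtain ⟨i, hi, hdir⟩ := exists_direction_eq hd g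
  have hdir' : inner ℝ (direction g) v ≤ -|g i| + κ := by
    rw [hdir]
    have := abs_le.mp (hg i)
    split_ifs with h0
    · rw [inner_neg_left, EuclideanSpace.inner_single_left, abs_of_nonneg h0]
      simp
      linarith
    · rw [EuclideanSpace.inner_single_left, abs_of_neg (not_le.mp h0)]
      simp
      linarith
  -- The error is paid twice: once at the chosen vertex, whose value is at most `-|g i| + κ`, and
  -- once here, where duality bounds every competitor below by `-(|g i| + κ)`.
  have hv : ∀ j, |v j| ≤ |g i| + κ := fun j => by
    have h1 := hi j
    have h2 := hg j
    have h3 := abs_sub_abs_le_abs_sub (v j) (g j)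
    rw [abs_sub_comm] at h3
    linarith
  have := (abs_le.mp (abs_inner_le hy ((abs_nonneg _).trans (hv i)) hv)).1
  linarith

end

/-! ### One Frank-Wolfe step -/

lemma stepSize_mem (t : ℕ) : stepSize t ∈ Set.Ioc (0 : ℝ) 1 := by
  have : (0 : ℝ) ≤ t := Nat.cast_nonneg t
  constructor
  · rw [stepSize]; positivity
  · rw [stepSize, div_le_one (by positivity)]; linarith

/-- The points of the ball that satisfy the error bound of the Frank-Wolfe iteration after `t`
rounds. -/
def goodPoints {d : ℕ} (f : Vec d → ℝ) (C : ℝ) (t : ℕ) : Set (Vec d) :=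
  {x | x ∈ l1Ball d ∧ (1 ≤ t → ∀ y ∈ l1Ball d, f x - f y ≤ 4 * C / (t + 2))}

lemma step_mem_goodPoints {d : ℕ} {f : Vec d → ℝ} {L C : ℝ} (hf : IsSmooth f L) (hL : 0 ≤ L)
    (hc : ConvexOn ℝ (l1Ball d) f) (hC : C = curvature f (l1Ball d)) (hC0 : 0 < C) {t : ℕ}
    {x s : Vec d} (hx : x ∈ goodPoints f C t) (hs : s ∈ l1Ball d)
    (hsub : ∀ y ∈ l1Ball d, inner ℝ s (gradient f x) ≤
      inner ℝ y (gradient f x) + C / (t + 2)) :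
    (1 - stepSize t) • x + stepSize t • s ∈ goodPoints f C (t + 1) := by
  have hγ := stepSize_mem t
  refine ⟨convex_l1Ball d hx.1 hs (by linarith [hγ.2]) hγ.1.le (by ring), fun _ y hy => ?_⟩
  rw [show (1 - stepSize t) • x + stepSize t • s = x + stepSize t • (s - x) by module]
  have h1 := le_add_curvature (hC ▸ hC0) hx.1 hs hγ
  rw [← hC] at h1
  have h2 := hsub y hy
  have h3 := hf.inner_gradient_le hL hc hx.1 hy
  rw [inner_sub_left] at h1 h3
  have h4 : f (x + stepSize t • (s - x)) - f y ≤ (1 - stepSize t) * (f x - f y) +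
      stepSize t * (C / (t + 2)) + stepSize t ^ 2 / 2 * C := by
    have := hγ.1
    nlinarith
  have e : stepSize t * (C / (t + 2)) + stepSize t ^ 2 / 2 * C = 4 * C / ((t : ℝ) + 2) ^ 2 := by
    rw [stepSize]; field_simp; ring
  have ht : (0 : ℝ) ≤ t := Nat.cast_nonneg t
  have h5 : (1 - stepSize t) * (f x - f y) ≤ t / (t + 2) * (4 * C / (t + 2)) := by
    have e2 : 1 - stepSize t = t / ((t : ℝ) + 2) := by rw [stepSize]; field_simp; ring
    rw [e2]
    -- In round `0` the step size is `1`: the factor `t/(t+2)` vanishes and no bound on the starting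
    -- point is needed.
    rcases Nat.eq_zero_or_pos t with h0 | h0
    · simp [h0]
    · exact mul_le_mul_of_nonneg_left (hx.2 h0 y hy) (by positivity)
  have h6 : t / ((t : ℝ) + 2) * (4 * C / (t + 2)) + 4 * C / ((t : ℝ) + 2) ^ 2 ≤
      4 * C / (((t + 1 : ℕ) : ℝ) + 2) := by
    rw [show t / ((t : ℝ) + 2) * (4 * C / (t + 2)) + 4 * C / ((t : ℝ) + 2) ^ 2 =
      4 * C * (t + 1) / ((t : ℝ) + 2) ^ 2 by field_simp; try ring]
    push_cast
    rw [div_le_div_iff₀ (by positivity) (by positivity)]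
    -- This amounts to `(t + 1)(t + 3) ≤ (t + 2)²`.
    nlinarith
  linarith

/-! ### The parameters of the gradient estimator -/

lemma le_two_pow_ceil_logb {a : ℝ} (ha : 0 < a) : a ≤ 2 ^ ⌈Real.logb 2 a⌉₊ := by
  rw [← Real.rpow_natCast]
  exact (Real.logb_le_iff_le_rpow (by norm_num) ha).mp (Nat.le_ceil _)

lemma two_pow_ceil_logb_le {a : ℝ} (ha : 1 ≤ a) : (2 : ℝ) ^ ⌈Real.logb 2 a⌉₊ ≤ 2 * a := by
  have ha0 : 0 < a := by linarith
  have h0 : 0 ≤ Real.logb 2 a := Real.logb_nonneg (by norm_num) ha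
  calc (2 : ℝ) ^ ⌈Real.logb 2 a⌉₊ = (2 : ℝ) ^ ((⌈Real.logb 2 a⌉₊ : ℕ) : ℝ) :=
        (Real.rpow_natCast _ _).symm
    _ ≤ (2 : ℝ) ^ (Real.logb 2 a + 1) :=
        Real.rpow_le_rpow_of_exponent_le (by norm_num) (Nat.ceil_lt_add_one h0).le
    _ = 2 * a := by
        rw [Real.rpow_add (by norm_num), Real.rpow_logb (by norm_num) (by norm_num) ha0,
          Real.rpow_one, mul_comm]

lemma two_pow_valBits_ge {d : ℕ} {ρ : ℝ} (hd : 0 < d) (hρ : 0 < ρ) :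
    8 * Real.pi * d / ρ ≤ 2 ^ valBits d ρ := by
  have hd' : (0 : ℝ) < d := by exact_mod_cast hd
  have hpi := Real.pi_pos
  have e : Real.logb 2 (16 * Real.pi * d / ρ) - 1 = Real.logb 2 (8 * Real.pi * d / ρ) := by
    rw [show 16 * Real.pi * d / ρ = (8 * Real.pi * d / ρ) * 2 by ring,
      Real.logb_mul (by positivity) (by norm_num), Real.logb_self_eq_one (by norm_num)]
    ring
  rw [valBits, e]
  exact le_two_pow_ceil_logb (by positivity)

/-- The value of `r_t` is tuned so that `L`, `π` and `d²` cancel. What remains is a grid fine enough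
for `d/ρ + 1` steps to stay within a gradient error `C/(2(t+2))`. -/
lemma addrBits_argument_eq {d : ℕ} {G L ρ C : ℝ} (t : ℕ) (hd : 0 < d) (hL : 0 < L)
    (hρ : 0 < ρ) (hC : 0 < C) :
    2 * G * ρ / (4 * Real.pi * d ^ 2 * L * gridSize d L ρ C t) =
      8 * (d / ρ + 1) * (G * (t + 2) / C) := by
  have hd' : (0 : ℝ) < d := by exact_mod_cast hd
  have hpi := Real.pi_pos
  have ht : (0 : ℝ) ≤ t := Nat.cast_nonneg t
  have hk : 0 < d / ρ + 1 := by positivity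
  have h2 : (t : ℝ) + 2 ≠ 0 := by positivity
  rw [gridSize]
  generalize (d : ℝ) / ρ + 1 = k at *
  field_simp
  ring

lemma address_lt {d b c : ℕ} (s : Wire d b c → Fin 2) (i : Fin d) : address s i < 2 ^ b := by
  have : address s i = (finFunctionFinEquiv fun j => s (addrWire i j) : Fin (2 ^ b)) :=
    (finFunctionFinEquiv_apply _).symm
  rw [this]
  exact Fin.is_lt _

lemma gridPoint_zero {d b c : ℕ} (x : Vec d) (s : Wire d b c → Fin 2) : gridPoint x 0 s = x := by
  simp [gridPoint]

/-- The phases of the gradient estimator differ from linear ones by at most `3ρ/(8d)`. -/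
lemma phase_error_le {d b c : ℕ} {f : Vec d → ℝ} {L G r ρ : ℝ} (hf : IsSmooth f L) (hL : 0 < L)
    (hG : 0 < G) (hr : 0 < r) (hρ : 0 < ρ) (hd : 0 < d)
    (hb : (2 : ℝ) ^ b ≤ 2 * (G * ρ / (4 * Real.pi * d ^ 2 * L * r)))
    (hc : 8 * Real.pi * d / ρ ≤ 2 ^ c) (x : Vec d) (s : Wire d b c → Fin 2) :
    |2 * Real.pi * ((oracleValue f x (r / 2 ^ b) (2 * G * r / (2 ^ b * 2 ^ c)) s -
          oracleValue f x 0 (2 * G * r / (2 ^ b * 2 ^ c)) s : ℤ) : ℝ) / 2 ^ c -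
        2 * Real.pi * ∑ i, gradient f x i / (2 * G) * ((address s i : ℝ) - 2 ^ b / 2)| ≤
      3 * ρ / (8 * d) := by
  have hd' : (0 : ℝ) < d := by exact_mod_cast hd
  have hpi := Real.pi_pos
  set B : ℝ := 2 ^ b with hB
  set c' : ℝ := 2 ^ c with hc'
  have hB0 : 0 < B := by positivity
  have hc0 : 0 < c' := by positivity
  set η : ℝ := 2 * G * r / (B * c') with hη
  have hη0 : 0 < η := by positivity
  set p := gridPoint x (r / B) s with hp
  set w : Fin d → ℝ := fun i => (address s i : ℝ) - B / 2 with hw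
  have hpx : p - x = (r / B) • WithLp.toLp 2 w := by
    rw [hp, gridPoint, add_sub_cancel_left]
  have hwle : ∀ i, |w i| ≤ B / 2 := fun i => by
    have h1 : (address s i : ℝ) < B := by rw [hB]; exact_mod_cast address_lt s i
    have h2 : (0 : ℝ) ≤ address s i := Nat.cast_nonneg _
    rw [abs_le]
    simp only [hw]
    constructor <;> linarith
  have hnorm : ‖p - x‖ ^ 2 ≤ d * r ^ 2 / 4 := by
    rw [hpx, norm_smul, mul_pow, EuclideanSpace.norm_sq_eq, Real.norm_eq_abs, sq_abs]
    calc (r / B) ^ 2 * ∑ i, ‖w i‖ ^ 2 ≤ (r / B) ^ 2 * ∑ _i : Fin d, (B / 2) ^ 2 := by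
          gcongr with i
          exact hwle i
      _ = d * r ^ 2 / 4 := by
          rw [Finset.sum_const, Finset.card_univ, Fintype.card_fin, nsmul_eq_mul]
          field_simp
          norm_num
  have hinner : inner ℝ (p - x) (gradient f x) = (r / B) * ∑ i, gradient f x i * w i := by
    rw [hpx, real_inner_smul_left, PiLp.inner_apply]
    rfl
  -- Grid points lie within `r/2` of `x` in every coordinate, so `‖p - x‖² ≤ d r²/4`; this controls
  -- the nonlinearity of `f`.
  have hE := (hf.abs_taylor_le hL.le x p).trans (mul_le_mul_of_nonneg_left hnorm hL.le)
  set E : ℝ := f p - f x - inner ℝ (p - x) (gradient f x) with hEdef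
  have hk₁ : |(oracleValue f x (r / B) η s : ℝ) - f p / η| ≤ 1 / 2 := by
    rw [abs_sub_comm]; exact abs_sub_round _
  have hk₀ : |(oracleValue f x 0 η s : ℝ) - f x / η| ≤ 1 / 2 := by
    rw [abs_sub_comm]
    have := abs_sub_round (f (gridPoint x 0 s) / η)
    rw [gridPoint_zero] at this
    rw [oracleValue, gridPoint_zero]
    exact this
  set R₁ : ℝ := (oracleValue f x (r / B) η s : ℝ) - f p / η with hR₁
  set R₀ : ℝ := (oracleValue f x 0 η s : ℝ) - f x / η with hR₀
  have hsum : ∑ i, gradient f x i / (2 * G) * ((address s i : ℝ) - B / 2) =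
      (∑ i, gradient f x i * w i) / (2 * G) := by
    rw [Finset.sum_div]
    exact Finset.sum_congr rfl fun i _ => by rw [hw]; ring
  have key : 2 * Real.pi * ((oracleValue f x (r / B) η s -
      oracleValue f x 0 η s : ℤ) : ℝ) / c' -
      2 * Real.pi * ∑ i, gradient f x i / (2 * G) * ((address s i : ℝ) - B / 2) =
      2 * Real.pi * (E * (B / (2 * G * r)) + (R₁ - R₀) / c') := by
    rw [hsum]
    push_cast
    rw [show (oracleValue f x (r / B) η s : ℝ) = f p / η + R₁ by rw [hR₁]; ring,
      show (oracleValue f x 0 η s : ℝ) = f x / η + R₀ by rw [hR₀]; ring, hEdef, hinner, hη]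
    field_simp
    ring
  rw [key, abs_mul, abs_of_pos (by positivity : 0 < 2 * Real.pi)]
  -- The nonlinearity grows with `B`, so this is where the upper bound on `2^b` is used. Times `2π`
  -- it contributes `ρ/(8d)`.
  have h1 : |E * (B / (2 * G * r))| ≤ ρ / (16 * Real.pi * d) := by
    rw [abs_mul, abs_of_pos (by positivity : 0 < B / (2 * G * r))]
    calc |E| * (B / (2 * G * r)) ≤ L * (d * r ^ 2 / 4) *
          (2 * (G * ρ / (4 * Real.pi * d ^ 2 * L * r)) / (2 * G * r)) := by gcongr
      _ = ρ / (16 * Real.pi * d) := by field_simp; norm_num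
  -- Two roundings of at most half a unit each; times `2π` they contribute `ρ/(4d)`.
  have h2 : |(R₁ - R₀) / c'| ≤ ρ / (8 * Real.pi * d) := by
    rw [abs_div, abs_of_pos hc0]
    have h3 : |R₁ - R₀| ≤ 1 := (abs_sub _ _).trans (by linarith)
    calc |R₁ - R₀| / c' ≤ 1 / (8 * Real.pi * d / ρ) := by gcongr
      _ = _ := one_div_div _ _
  calc 2 * Real.pi * |E * (B / (2 * G * r)) + (R₁ - R₀) / c'|
      ≤ 2 * Real.pi * (ρ / (16 * Real.pi * d) + ρ / (8 * Real.pi * d)) := by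
        gcongr
        exact (abs_add_le _ _).trans (add_le_add h1 h2)
    _ = 3 * ρ / (8 * d) := by field_simp; norm_num

/-! ### Failure probability of one round -/

/-- The failure probability for one component of the gradient. -/
lemma jordanCircuit_component_failure_le {d b c : ℕ} {f : Vec d → ℝ} {L G r ρ : ℝ}
    (hf : IsSmooth f L) (hL : 0 < L) (hG : 0 < G) (hr : 0 < r) (hρ : 0 < ρ) (hρ1 : ρ ≤ 1)
    (hd : 0 < d) (hb : (2 : ℝ) ^ b ≤ 2 * (G * ρ / (4 * Real.pi * d ^ 2 * L * r)))
    (hb' : 4 * (d / ρ + 1) < (2 : ℝ) ^ b) (hc : 8 * Real.pi * d / ρ ≤ 2 ^ c) (x : Vec d)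
    (i : Fin d) (hv : |gradient f x i| ≤ G / 2) :
    ((jordanCircuit d b c x r G).law f).toOuterMeasure
        {m | d / ρ + 1 < |(m i : ℝ) - 2 ^ b * (1 / 2 + gradient f x i / (2 * G))|} ≤
      ENNReal.ofReal (ρ / d) := by
  classical
  have hd' : (0 : ℝ) < d := by exact_mod_cast hd
  have hd1 : (1 : ℝ) ≤ d := by exact_mod_cast hd
  have hpi := Real.pi_pos
  set θ : ℝ := 1 / 2 + gradient f x i / (2 * G) with hθ
  set h : ℕ → ℝ≥0∞ := fun m => if d / ρ + 1 < |(m : ℝ) - 2 ^ b * θ| then 1 else 0 with hh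
  have hmeas : ((jordanCircuit d b c x r G).law f).toOuterMeasure
        {m | d / ρ + 1 < |(m i : ℝ) - 2 ^ b * θ|} =
      (jordanCircuit d b c x r G).expect f (zeroState _) fun a => h (a i) := by
    rw [PMF.toOuterMeasure_apply, QProg.expect]
    refine tsum_congr fun a => ?_
    rw [Set.indicator_apply]
    by_cases ha : d / ρ + 1 < |(a i : ℝ) - 2 ^ b * θ|
    · have hm : a ∈ {m : Fin d → ℕ | d / ρ + 1 < |(m i : ℝ) - 2 ^ b * θ|} := ha
      simp only [hh, if_pos ha, if_pos hm, mul_one]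
      rfl
    · have hm : a ∉ {m : Fin d → ℕ | d / ρ + 1 < |(m i : ℝ) - 2 ^ b * θ|} := ha
      simp only [hh, if_neg ha, if_neg hm, mul_zero]
  have hbound := two_mul_expect_jordanCircuit_le (b := b) (c := c) f x r G
    (fun i => gradient f x i) h (fun m => by simp only [hh]; split <;> simp) i
    (3 * ρ / (8 * d)) (by positivity) fun s => phase_error_le hf hL hG hr hρ hd hb hc x s
  rw [← hmeas] at hbound
  -- Running the estimator with twice the Lipschitz constant keeps the phase away from the ends of
  -- `[0, 1]`, where outcomes would wrap around.
  have hθ1 : 1 / 4 ≤ θ ∧ θ ≤ 3 / 4 := by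
    have hq : |gradient f x i / (2 * G)| ≤ 1 / 4 := by
      rw [abs_div, abs_of_pos (by positivity : 0 < 2 * G), div_le_iff₀ (by positivity)]
      linarith
    have := abs_le.mp hq
    constructor <;> linarith
  have hk1 : 1 ≤ d / ρ + 1 := by
    have : 0 < d / ρ := by positivity
    linarith
  have htail := sum_cosProd_tail_le b hk1 hb' hθ1.1 hθ1.2
  have hsum : ∑ m ∈ Finset.range (2 ^ b), ENNReal.ofReal
        (cosProd b (Real.pi * (1 / 2 + gradient f x i / (2 * G) - (m : ℝ) / 2 ^ b))) * h m ≤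
      ENNReal.ofReal (ρ / d / 3) := by
    simp only [hh, mul_ite, mul_one, mul_zero]
    rw [← Finset.sum_filter, ← hθ, ← ENNReal.ofReal_sum_of_nonneg fun _ _ => cosProd_nonneg _ _]
    refine ENNReal.ofReal_le_ofReal (htail.trans ?_)
    calc 1 / (Real.pi * (d / ρ + 1 - 1 / 2)) ≤ 1 / (3 * (d / ρ)) := by
          apply one_div_le_one_div_of_le (by positivity)
          have h3 := Real.pi_gt_three
          have : 0 < d / ρ := by positivity
          nlinarith
      _ = ρ / d / 3 := by field_simp
  have hq1 : ρ / d ≤ 1 := by rw [div_le_one hd']; linarith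
  have hq0 : 0 < ρ / d := by positivity
  have htotal : 2 * ((jordanCircuit d b c x r G).law f).toOuterMeasure
        {m | d / ρ + 1 < |(m i : ℝ) - 2 ^ b * θ|} ≤ 2 * ENNReal.ofReal (ρ / d) := by
    refine hbound.trans ((add_le_add (mul_le_mul' le_rfl hsum) le_rfl).trans ?_)
    rw [show (3 : ℝ≥0∞) = ENNReal.ofReal 3 by simp, show (6 : ℝ≥0∞) = ENNReal.ofReal 6 by simp,
      show (2 : ℝ≥0∞) = ENNReal.ofReal 2 by simp, ← ENNReal.ofReal_mul (by norm_num),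
      ← ENNReal.ofReal_mul (by norm_num), ← ENNReal.ofReal_mul (by norm_num),
      ← ENNReal.ofReal_add (by positivity) (by positivity)]
    apply ENNReal.ofReal_le_ofReal
    -- With `q = ρ/d ≤ 1` the bound reads `3 · q/3 + 6 (3q/8)² = q + (27/32) q² ≤ 2q`.
    rw [show 3 * ρ / (8 * d) = 3 / 8 * (ρ / d) by field_simp]
    nlinarith
  exact (ENNReal.mul_le_mul_iff_right (by norm_num) (by norm_num)).mp htotal

lemma toOuterMeasure_le_one {α : Type*} (p : PMF α) (s : Set α) :
    p.toOuterMeasure s ≤ 1 := by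
  rw [← p.tsum_coe, PMF.toOuterMeasure_apply]
  exact ENNReal.tsum_le_tsum fun a => Set.indicator_le_self _ _ _

/-- One round of the algorithm preserves the error bound except with probability `ρ`. -/
lemma round_failure_le {d : ℕ} {f : Vec d → ℝ} {G L C ρ : ℝ}
    (hc : ConvexOn ℝ (l1Ball d) f) (hf : IsSmooth f L) (hl : IsLipschitzOn f G (l1Ball d))
    (hC : C = curvature f (l1Ball d)) (hC0 : 0 < C) (hρ : 0 < ρ) (hρ1 : ρ ≤ 1) {t : ℕ}
    {x : Vec d} (hx : x ∈ goodPoints f C t) :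
    ((roundProgram d G L ρ C t x).law f).toOuterMeasure
      {m | nextIterate d G L ρ C t x m ∉ goodPoints f C (t + 1)} ≤ ENNReal.ofReal ρ := by
  have hcurv : 0 < curvature f (l1Ball d) := hC ▸ hC0
  have hd := dim_pos_of_curvature_pos hcurv
  have hL := smoothness_pos_of_curvature_pos hf hcurv
  have hG := lipschitz_pos_of_curvature_pos hf hl hcurv
  have hd' : (0 : ℝ) < d := by exact_mod_cast hd
  have ht : (0 : ℝ) ≤ t := Nat.cast_nonneg t
  have hpi := Real.pi_pos
  have hgrad := abs_gradient_apply_le hf hG.le hl hx.1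
  -- If `2G ≤ C/(t+2)`, any point of the ball solves the subproblem accurately enough and the
  -- measurement is irrelevant. Otherwise `2^b` exceeds `4(d/ρ + 1)`, as the tail bound requires.
  rcases le_or_gt (2 * G * (t + 2)) C with hbig | hsmall
  · have hempty : {m | nextIterate d G L ρ C t x m ∉ goodPoints f C (t + 1)} = ∅ := by
      refine Set.eq_empty_of_forall_notMem fun m hm => hm ?_
      refine step_mem_goodPoints hf hL.le hc hC hC0 hx (direction_mem hd _) fun y hy => ?_
      have h1 := (abs_le.mp (abs_inner_le (direction_mem hd
        (gradientEstimate (addrBits d (2 * G) L ρ (gridSize d L ρ C t)) (2 * G) m))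
        hG.le hgrad)).2
      have h2 := (abs_le.mp (abs_inner_le hy hG.le hgrad)).1
      have h3 : 2 * G ≤ C / (t + 2) := by rwa [le_div_iff₀ (by positivity)]
      linarith
    rw [hempty]
    simp
  · set r := gridSize d L ρ C t with hr
    set b := addrBits d (2 * G) L ρ r with hb
    have hk : 0 < d / ρ + 1 := by positivity
    have hk1 : 1 < d / ρ + 1 := by
      have : 0 < d / ρ := by positivity
      linarith
    have hr0 : 0 < r := by rw [hr, gridSize]; positivity
    have harg := addrBits_argument_eq (G := G) t hd hL hρ hC0
    rw [← hr] at harg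
    have hGC : 1 / 2 < G * (t + 2) / C := by rw [lt_div_iff₀ hC0]; linarith
    have harg4 : 4 * (d / ρ + 1) < 2 * G * ρ / (4 * Real.pi * d ^ 2 * L * r) := by
      rw [harg]; nlinarith
    have hb1 : 2 * G * ρ / (4 * Real.pi * d ^ 2 * L * r) ≤ (2 : ℝ) ^ b :=
      le_two_pow_ceil_logb (by linarith)
    have hb2 : (2 : ℝ) ^ b ≤ 2 * (2 * G * ρ / (4 * Real.pi * d ^ 2 * L * r)) :=
      two_pow_ceil_logb_le (by linarith)
    have hsub : {m | nextIterate d G L ρ C t x m ∉ goodPoints f C (t + 1)} ⊆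
        ⋃ i, {m : Fin d → ℕ |
          d / ρ + 1 < |(m i : ℝ) - 2 ^ b * (1 / 2 + gradient f x i / (2 * (2 * G)))|} := by
      intro m hm
      by_contra hno
      simp only [Set.mem_iUnion, not_exists] at hno
      apply hm
      refine step_mem_goodPoints hf hL.le hc hC hC0 hx (direction_mem hd _) fun y hy => ?_
      have hest : ∀ i, |gradientEstimate b (2 * G) m i - gradient f x i| ≤
          C / (2 * (t + 2)) := by
        intro i
        have hi : |(m i : ℝ) - 2 ^ b * (1 / 2 + gradient f x i / (2 * (2 * G)))| ≤ d / ρ + 1 :=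
          not_lt.mp (hno i)
        have hB : (0 : ℝ) < 2 ^ b := by positivity
        have e : gradientEstimate b (2 * G) m i - gradient f x i = 2 * (2 * G) / 2 ^ b *
            ((m i : ℝ) - 2 ^ b * (1 / 2 + gradient f x i / (2 * (2 * G)))) := by
          rw [gradientEstimate]
          field_simp
          ring
        rw [e, abs_mul, abs_of_pos (by positivity)]
        calc 2 * (2 * G) / 2 ^ b * |(m i : ℝ) - 2 ^ b *
              (1 / 2 + gradient f x i / (2 * (2 * G)))|
            ≤ 2 * (2 * G) / (8 * (d / ρ + 1) * (G * (t + 2) / C)) * (d / ρ + 1) := by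
              gcongr
              rw [← harg]
              exact hb1
          _ = C / (2 * (t + 2)) := by
              generalize (d : ℝ) / ρ + 1 = k at *
              field_simp
              norm_num
      refine (inner_direction_le hd _ _ hest hy).trans_eq ?_
      congr 1
      field_simp
    calc _ ≤ ((roundProgram d G L ρ C t x).law f).toOuterMeasure
          (⋃ i, {m : Fin d → ℕ |
          d / ρ + 1 < |(m i : ℝ) - 2 ^ b * (1 / 2 + gradient f x i / (2 * (2 * G)))|}) :=
          MeasureTheory.OuterMeasure.mono _ hsub
      _ ≤ ∑ i, ((roundProgram d G L ρ C t x).law f).toOuterMeasure {m : Fin d → ℕ |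
          d / ρ + 1 < |(m i : ℝ) - 2 ^ b * (1 / 2 + gradient f x i / (2 * (2 * G)))|} := by
          have := MeasureTheory.measure_iUnion_fintype_le
            ((roundProgram d G L ρ C t x).law f).toOuterMeasure
            fun i => {m : Fin d → ℕ |
              d / ρ + 1 < |(m i : ℝ) - 2 ^ b * (1 / 2 + gradient f x i / (2 * (2 * G)))|}
          exact this
      _ ≤ ∑ _i : Fin d, ENNReal.ofReal (ρ / d) := by
          refine Finset.sum_le_sum fun i _ => ?_
          exact jordanCircuit_component_failure_le hf hL (by positivity) hr0 hρ hρ1 hd hb2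
            (harg4.trans_le hb1) (two_pow_valBits_ge hd hρ) x i (by linarith [hgrad i])
      _ = ENNReal.ofReal ρ := by
          rw [Finset.sum_const, Finset.card_univ, Fintype.card_fin, nsmul_eq_mul,
            ← ENNReal.ofReal_natCast, ← ENNReal.ofReal_mul (by positivity)]
          congr 1
          field_simp

/-! ### The whole iteration -/

lemma iterate_failure_le {d : ℕ} {f : Vec d → ℝ} {G L C ρ : ℝ}
    (hc : ConvexOn ℝ (l1Ball d) f) (hf : IsSmooth f L) (hl : IsLipschitzOn f G (l1Ball d))
    (hC : C = curvature f (l1Ball d)) (hC0 : 0 < C) (hρ : 0 < ρ) (hρ1 : ρ ≤ 1) {x₀ : Vec d}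
    (hx₀ : x₀ ∈ l1Ball d) (t : ℕ) :
    (iterateLaw f G L ρ C x₀ t).toOuterMeasure (goodPoints f C t)ᶜ ≤ t * ENNReal.ofReal ρ := by
  classical
  induction t with
  | zero =>
    have : x₀ ∈ goodPoints f C 0 := ⟨hx₀, fun h => absurd h (by norm_num)⟩
    rw [iterateLaw, PMF.toOuterMeasure_pure_apply, if_neg (by simpa using this)]
    simp
  | succ t ih =>
    rw [iterateLaw, PMF.toOuterMeasure_bind_apply]
    -- The conditional failure probability is bounded by one at points that are already bad and by
    -- `ρ` at good ones.
    have step : ∀ x, iterateLaw f G L ρ C x₀ t x *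
        (((roundProgram d G L ρ C t x).law f).map (nextIterate d G L ρ C t x)).toOuterMeasure
          (goodPoints f C (t + 1))ᶜ ≤
        (goodPoints f C t)ᶜ.indicator (iterateLaw f G L ρ C x₀ t) x +
          iterateLaw f G L ρ C x₀ t x * ENNReal.ofReal ρ := by
      intro x
      by_cases hx : x ∈ goodPoints f C t
      · refine le_add_left (mul_le_mul' le_rfl ?_)
        rw [PMF.toOuterMeasure_map_apply]
        exact round_failure_le hc hf hl hC hC0 hρ hρ1 hx
      · rw [Set.indicator_of_mem hx]
        exact le_add_right
          ((mul_le_mul' le_rfl (toOuterMeasure_le_one _ _)).trans_eq (mul_one _))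
    refine (ENNReal.tsum_le_tsum step).trans ?_
    rw [ENNReal.tsum_add, ← PMF.toOuterMeasure_apply, ENNReal.tsum_mul_right, PMF.tsum_coe,
      one_mul, Nat.cast_add, Nat.cast_one, add_mul, one_mul]
    gcongr

lemma toOuterMeasure_add_compl {α : Type*} (p : PMF α) (s : Set α) :
    p.toOuterMeasure s + p.toOuterMeasure sᶜ = 1 := by
  rw [PMF.toOuterMeasure_apply, PMF.toOuterMeasure_apply, ← ENNReal.tsum_add, ← p.tsum_coe]
  exact tsum_congr fun a => congrFun (Set.indicator_self_add_compl s p) a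

lemma le_rounds (C ε : ℝ) : 4 * C / ε - 2 ≤ rounds C ε := by
  refine (Nat.le_ceil _).trans ?_
  exact_mod_cast le_max_right _ _

theorem success_probability {d : ℕ} {f : Vec d → ℝ} {G L C ρ ε : ℝ}
    (hc : ConvexOn ℝ (l1Ball d) f) (hf : IsSmooth f L) (hl : IsLipschitzOn f G (l1Ball d))
    (hC : C = curvature f (l1Ball d)) (hC0 : 0 < C) (hρ : 0 < ρ) (hρ1 : ρ ≤ 1) (hε : 0 < ε)
    {x₀ : Vec d} (hx₀ : x₀ ∈ l1Ball d) :
    ENNReal.ofReal (1 - rounds C ε * ρ) ≤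
      (iterateLaw f G L ρ C x₀ (rounds C ε)).toOuterMeasure
        {x | x ∈ l1Ball d ∧ ∀ y ∈ l1Ball d, f x - f y ≤ ε} := by
  have hfail := iterate_failure_le hc hf hl hC hC0 hρ hρ1 hx₀ (rounds C ε)
  have hsub : goodPoints f C (rounds C ε) ⊆
      {x | x ∈ l1Ball d ∧ ∀ y ∈ l1Ball d, f x - f y ≤ ε} := by
    intro x hx
    refine ⟨hx.1, fun y hy => (hx.2 (le_max_left _ _) y hy).trans ?_⟩
    have := le_rounds C ε
    rw [div_le_iff₀ (by positivity)]
    rw [sub_le_iff_le_add, div_le_iff₀ hε] at this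
    linarith
  refine le_trans ?_ (MeasureTheory.OuterMeasure.mono _ hsub)
  have hone := toOuterMeasure_add_compl (iterateLaw f G L ρ C x₀ (rounds C ε))
    (goodPoints f C (rounds C ε))
  rw [ENNReal.ofReal_sub _ (by positivity), ENNReal.ofReal_one, ← hone,
    ENNReal.ofReal_mul (by positivity), ENNReal.ofReal_natCast]
  exact tsub_le_iff_right.mpr (add_le_add le_rfl hfail)

/-! ### Resources -/

section
variable {d b c : ℕ} {α : Type}

lemma gates_runGates (gs : List (Gate (Wire d b c))) (k : QProg d b c α) :
    (runGates gs k).gates = gs.length + k.gates := by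
  induction gs with
  | nil => simp [runGates]
  | cons g gs ih =>
    have : (runGates (g :: gs) k).gates = (runGates gs k).gates + 1 := rfl
    rw [this, ih, List.length_cons]
    ring

lemma queries_runGates (gs : List (Gate (Wire d b c))) (k : QProg d b c α) :
    (runGates gs k).queries = k.queries := by
  induction gs with
  | nil => rfl
  | cons g gs ih => exact ih

lemma length_adder {Q : Type} (l : List (Q × Q)) (z : Q) : (adder l z).length = 6 * l.length := by
  induction l generalizing z with
  | nil => rfl
  | cons p l ih => simp [adder, ih]; ring

lemma gates_iqftMeasure_le (cont : ℕ → QProg d b c α) (n : ℕ) (hn : ∀ M, (cont M).gates ≤ n)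
    (l : List (Wire d b c)) (k M : ℕ) :
    (iqftMeasure cont l k M).gates ≤ 3 * l.length + n := by
  induction l generalizing k M with
  | nil => simpa [iqftMeasure] using hn M
  | cons q l ih =>
    have h0 := ih (k + 1) (M + ((0 : Fin 2) : ℕ) * 2 ^ k)
    have h1 := ih (k + 1) (M + ((1 : Fin 2) : ℕ) * 2 ^ k)
    simp only [iqftMeasure, QProg.gates, List.length_cons]
    omega

lemma queries_iqftMeasure (cont : ℕ → QProg d b c α) (hn : ∀ M, (cont M).queries = 0)
    (l : List (Wire d b c)) (k M : ℕ) : (iqftMeasure cont l k M).queries = 0 := by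
  induction l generalizing k M with
  | nil => exact hn M
  | cons q l ih => simp only [iqftMeasure, QProg.queries, ih, max_self]

lemma gates_measureRegisters_le (is : List (Fin d)) (m : Fin d → ℕ) :
    (measureRegisters is m : QProg d b c _).gates ≤ 3 * b * is.length := by
  induction is generalizing m with
  | nil => simp [measureRegisters, QProg.gates]
  | cons i is ih =>
    refine (gates_iqftMeasure_le _ (3 * b * is.length) (fun M => ih _) _ 0 0).trans_eq ?_
    simp
    ring

lemma queries_measureRegisters (is : List (Fin d)) (m : Fin d → ℕ) :
    (measureRegisters is m : QProg d b c _).queries = 0 := by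
  induction is generalizing m with
  | nil => rfl
  | cons i is ih => exact queries_iqftMeasure _ (fun M => ih _) _ 0 0

lemma queries_jordanCircuit (x : Vec d) (r G : ℝ) : (jordanCircuit d b c x r G).queries = 4 := by
  simp only [jordanCircuit, queries_runGates, QProg.queries, queries_measureRegisters]

/-- Per value bit: two gates of preparation and six of the adder. Per address qubit: a Hadamard
gate, a sign, and the rotation, Hadamard gate and measurement of the semiclassical transform. -/
lemma gates_jordanCircuit_le (x : Vec d) (r G : ℝ) :
    (jordanCircuit d b c x r G).gates ≤ 8 * c + 5 * (d * b) := by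
  have h := gates_measureRegisters_le (b := b) (c := c) (List.finRange d) 0
  simp only [jordanCircuit, gates_runGates, QProg.gates, length_adder, List.length_flatMap,
    List.length_map, List.length_finRange, List.length_cons, List.length_nil, List.map_const',
    List.sum_replicate, smul_eq_mul] at h ⊢
  nlinarith

lemma card_wire : Fintype.card (Wire d b c) = d * b + 2 * c + 1 := by
  simp [Wire]
  ring

end

/-! ### Register lengths in terms of `log (G d / (ρ ε₀))` -/

lemma ceil_logb_le_of_le {a X : ℝ} (k : ℕ) (ha : 0 < a) (hX : 2 ≤ X) (h : a ≤ 2 ^ k * X) :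
    (⌈Real.logb 2 a⌉₊ : ℝ) ≤ k + 1 + Real.logb 2 X := by
  have hX0 : 0 < X := by linarith
  have hlogX : 0 ≤ Real.logb 2 X := Real.logb_nonneg (by norm_num) (by linarith)
  have h1 : Real.logb 2 a ≤ k + Real.logb 2 X := by
    refine (Real.logb_le_logb_of_le (by norm_num) ha h).trans_eq ?_
    rw [Real.logb_mul (by positivity) hX0.ne', Real.logb_pow, Real.logb_self_eq_one (by norm_num),
      mul_one]
  calc (⌈Real.logb 2 a⌉₊ : ℝ) ≤ (⌈(k : ℝ) + Real.logb 2 X⌉₊ : ℝ) := by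
        exact_mod_cast Nat.ceil_le_ceil h1
    _ ≤ k + Real.logb 2 X + 1 := (Nat.ceil_lt_add_one (by positivity)).le
    _ = _ := by ring

/-- The round numbers are small compared with `1/ε`. -/
lemma mul_round_div_le {C ε ε₀ G : ℝ} (hC : 0 < C) (hε : 0 < ε) (hG : 0 < G)
    (hε₀ : ε₀ = min ε (min (G / 2) (2 * C))) {t : ℕ} (ht : t < rounds C ε) :
    G * (t + 2) / C ≤ 4 * G / ε₀ := by
  have h1 : ε₀ ≤ ε := hε₀ ▸ min_le_left _ _
  have h2 : ε₀ ≤ 2 * C := hε₀ ▸ (min_le_right _ _).trans (min_le_right _ _)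
  have h0 : 0 < ε₀ := by rw [hε₀]; positivity
  -- If there is a single round then `t = 0`, and `ε₀ ≤ 2C` gives the claim. Otherwise `t + 1` is at
  -- most the ceiling, which is below `4C/ε - 1`.
  have ht2 : (t : ℝ) + 2 ≤ 4 * C / ε₀ := by
    rcases lt_or_ge (4 * C / ε - 2) 1 with h | h
    · have hceil : ⌈4 * C / ε - 2⌉₊ ≤ 1 := Nat.ceil_le.mpr (by exact_mod_cast h.le)
      have : rounds C ε = 1 := max_eq_left hceil
      have ht0 : t = 0 := by omega
      rw [ht0, le_div_iff₀ h0]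
      push_cast
      linarith
    · have hceil : 1 ≤ ⌈4 * C / ε - 2⌉₊ := Nat.one_le_ceil_iff.mpr (by linarith)
      have hr : rounds C ε = ⌈4 * C / ε - 2⌉₊ := max_eq_right hceil
      have hlt := Nat.ceil_lt_add_one (show 0 ≤ 4 * C / ε - 2 by linarith)
      have : (t : ℝ) + 1 ≤ ⌈4 * C / ε - 2⌉₊ := by exact_mod_cast hr ▸ ht
      have h3 : 4 * C / ε ≤ 4 * C / ε₀ := by gcongr
      linarith
  calc G * (t + 2) / C ≤ G * (4 * C / ε₀) / C := by gcongr
    _ = 4 * G / ε₀ := by field_simp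

lemma register_sizes_le {d : ℕ} {G L C ρ ε ε₀ : ℝ} (hd : 0 < d) (hL : 0 < L) (hG : 0 < G)
    (hC : 0 < C) (hρ : 0 < ρ) (hρ1 : ρ ≤ 1) (hε : 0 < ε)
    (hε₀ : ε₀ = min ε (min (G / 2) (2 * C))) {t : ℕ} (ht : t < rounds C ε) :
    2 ≤ G * d / (ρ * ε₀) ∧
    (addrBits d (2 * G) L ρ (gridSize d L ρ C t) : ℝ) ≤
      8 * Real.logb 2 (G * d / (ρ * ε₀)) ∧
    (valBits d ρ : ℝ) ≤ 7 * Real.logb 2 (G * d / (ρ * ε₀)) := by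
  have hd1 : (1 : ℝ) ≤ d := by exact_mod_cast hd
  have hd0 : (0 : ℝ) < d := by linarith
  have h0 : 0 < ε₀ := by rw [hε₀]; positivity
  have hεG : ε₀ ≤ G / 2 := hε₀ ▸ (min_le_right _ _).trans (min_le_left _ _)
  have hGε : 2 ≤ G / ε₀ := by rw [le_div_iff₀ h0]; linarith
  have hdρ : 1 ≤ d / ρ := by rw [le_div_iff₀ hρ]; linarith
  have hX : G * d / (ρ * ε₀) = d / ρ * (G / ε₀) := by field_simp
  have hX2 : 2 ≤ G * d / (ρ * ε₀) := by rw [hX]; nlinarith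
  have hlog : 1 ≤ Real.logb 2 (G * d / (ρ * ε₀)) := by
    rw [Real.le_logb_iff_rpow_le (by norm_num) (by linarith), Real.rpow_one]
    exact hX2
  have harg := addrBits_argument_eq (G := G) t hd hL hρ hC
  have hround := mul_round_div_le hC hε hG hε₀ ht
  have ht0 : (0 : ℝ) ≤ t := Nat.cast_nonneg t
  refine ⟨hX2, ?_, ?_⟩
  -- Seven plus the logarithm is at most eight times it, since `X ≥ 2`; that is why `ε₀` is capped
  -- by `G/2`.
  · refine (ceil_logb_le_of_le (X := G * d / (ρ * ε₀)) 6 ?_ hX2 ?_).trans ?_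
    · rw [harg]; positivity
    · rw [harg, hX]
      calc 8 * (d / ρ + 1) * (G * (t + 2) / C) ≤ 8 * (d / ρ + d / ρ) * (4 * G / ε₀) := by gcongr
        _ = 2 ^ 6 * (d / ρ * (G / ε₀)) := by ring
    · push_cast; linarith
  · have hv : Real.logb 2 (16 * Real.pi * d / ρ) - 1 = Real.logb 2 (8 * Real.pi * d / ρ) := by
      have hpi := Real.pi_pos
      rw [show 16 * Real.pi * d / ρ = (8 * Real.pi * d / ρ) * 2 by ring,
        Real.logb_mul (by positivity) (by norm_num), Real.logb_self_eq_one (by norm_num)]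
      ring
    rw [valBits, hv]
    refine (ceil_logb_le_of_le (X := G * d / (ρ * ε₀)) 5 ?_ hX2 ?_).trans ?_
    · have hpi := Real.pi_pos
      positivity
    · rw [hX]
      have hpi := Real.pi_le_four
      calc 8 * Real.pi * d / ρ = 8 * Real.pi * (d / ρ) := by ring
        _ ≤ 8 * 4 * (d / ρ) := by gcongr
        _ ≤ 2 ^ 5 * (d / ρ * (G / ε₀)) := by nlinarith
    · push_cast; linarith

/-- From `D ≥ 2` one has `2 log D ≥ 2 log 2 > 1`, so the sum `log Y + log D` is absorbed into a
product. -/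
lemma log_mul_le_mul_log {Y D : ℝ} (hY : 2 ≤ Y) (hD : 2 ≤ D) :
    Real.log (Y * D) ≤ 2 * ((1 + Real.log Y) * Real.log D) := by
  have h2 := Real.log_two_gt_d9
  have hl : Real.log 2 ≤ Real.log D := Real.log_le_log (by norm_num) hD
  have hY0 : 0 ≤ Real.log Y := Real.log_nonneg (by linarith)
  rw [Real.log_mul (by linarith) (by linarith)]
  nlinarith

end QFW

/-! ### Success probability and universal resource constants combined -/

theorem theorem3 :
    ∃ K : ℝ, 0 < K ∧
      ∀ (d : ℕ) (f : QFW.Vec d → ℝ) (G L C ρ ε ε₀ : ℝ) (x₀ : QFW.Vec d),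
        ConvexOn ℝ (QFW.l1Ball d) f →
        QFW.IsSmooth f L →
        QFW.IsLipschitzOn f G (QFW.l1Ball d) →
        C = QFW.curvature f (QFW.l1Ball d) → 0 < C →
        0 < ρ → ρ ≤ 1 → 0 < ε → x₀ ∈ QFW.l1Ball d →
        ε₀ = min ε (min (G / 2) (2 * C)) →
        ENNReal.ofReal (1 - QFW.rounds C ε * ρ) ≤
            (QFW.iterateLaw f G L ρ C x₀ (QFW.rounds C ε)).toOuterMeasure
              {x | x ∈ QFW.l1Ball d ∧ ∀ y ∈ QFW.l1Ball d, f x - f y ≤ ε} ∧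
          ∀ t < QFW.rounds C ε, ∀ x : QFW.Vec d,
            (QFW.roundProgram d G L ρ C t x).queries = 4 ∧
            ((QFW.roundProgram d G L ρ C t x).qubits : ℝ) ≤
              K * (d * Real.log (G * d / (ρ * ε₀))) ∧
            ((QFW.roundProgram d G L ρ C t x).gates : ℝ) ≤
              K * (d * Real.log (G * d / (ρ * ε₀))) ∧
            (2 ≤ d → ((QFW.roundProgram d G L ρ C t x).gates : ℝ) ≤
              K * (1 + Real.log (G / (ρ * ε₀))) * (d * Real.log d)) := by
  -- With `log 2 > 1/2` one gets `b ≤ 16 log X` and `c ≤ 14 log X`, hence at most `8 · 14 + 5 · 16 =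
  -- 192` times `d log X` gates. The factor 2 of `log_mul_le_mul_log` doubles this to `384`.
  refine ⟨384, by norm_num, ?_⟩
  intro d f G L C ρ ε ε₀ x₀ hc hf hl hC hC0 hρ hρ1 hε hx₀ hε₀
  refine ⟨QFW.success_probability hc hf hl hC hC0 hρ hρ1 hε hx₀, fun t ht x => ?_⟩
  have hcurv : 0 < QFW.curvature f (QFW.l1Ball d) := hC ▸ hC0
  have hd := QFW.dim_pos_of_curvature_pos hcurv
  have hL := QFW.smoothness_pos_of_curvature_pos hf hcurv
  have hG := QFW.lipschitz_pos_of_curvature_pos hf hl hcurv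
  obtain ⟨hX, hb, hv⟩ := QFW.register_sizes_le hd hL hG hC0 hρ hρ1 hε hε₀ ht
  have hd1 : (1 : ℝ) ≤ d := by exact_mod_cast hd
  set X : ℝ := G * d / (ρ * ε₀) with hXdef
  set b := QFW.addrBits d (2 * G) L ρ (QFW.gridSize d L ρ C t) with hbdef
  set c := QFW.valBits d ρ with hcdef
  have hlog2 := Real.log_two_gt_d9
  have hlogX : Real.log 2 ≤ Real.log X := Real.log_le_log (by norm_num) hX
  have hlogX0 : 0 < Real.log X := by linarith
  have hlogb : Real.logb 2 X ≤ 2 * Real.log X := by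
    rw [Real.logb, div_le_iff₀ (by linarith)]
    nlinarith
  have hdlog : Real.log X ≤ d * Real.log X := le_mul_of_one_le_left hlogX0.le hd1
  have hdb : (d : ℝ) * b ≤ 16 * (d * Real.log X) := by
    calc (d : ℝ) * b ≤ d * (8 * (2 * Real.log X)) := by gcongr; linarith
      _ = _ := by ring
  have hc14 : (c : ℝ) ≤ 14 * (d * Real.log X) := by linarith
  have hgates : ((QFW.roundProgram d G L ρ C t x).gates : ℝ) ≤ 192 * (d * Real.log X) := by
    have h1 : ((QFW.roundProgram d G L ρ C t x).gates : ℝ) ≤ 8 * c + 5 * (d * b) := by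
      exact_mod_cast QFW.gates_jordanCircuit_le (b := b) (c := c) x
        (QFW.gridSize d L ρ C t) (2 * G)
    linarith
  have hdX : 0 ≤ d * Real.log X := by positivity
  refine ⟨QFW.queries_jordanCircuit x _ _, ?_, by linarith, fun hd2 => hgates.trans ?_⟩
  · rw [QFW.QProg.qubits, QFW.card_wire]
    push_cast
    linarith
  · have hd2' : (2 : ℝ) ≤ d := by exact_mod_cast hd2
    have h0 : 0 < ε₀ := by rw [hε₀]; positivity
    have hεG : ε₀ ≤ G / 2 := hε₀ ▸ (min_le_right _ _).trans (min_le_left _ _)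
    have hY : 2 ≤ G / (ρ * ε₀) := by
      rw [le_div_iff₀ (by positivity)]
      nlinarith
    have hXY : X = G / (ρ * ε₀) * d := by rw [hXdef]; ring
    have := QFW.log_mul_le_mul_log hY hd2'
    rw [← hXY] at this
    calc 192 * (d * Real.log X)
        ≤ 192 * (d * (2 * ((1 + Real.log (G / (ρ * ε₀))) * Real.log d))) := by gcongr
      _ = _ := by ring
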